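/- Let $\mathrm{Vir}$ be the complex Lie algebra with basis $\{c, d_i : i\in\mathbb Z\}$, $c$ central, and $[d_i,d_j]=(j-i)d_{i+j}+\delta_{i,-j}\frac{i^3-i}{12}c$. For $\lambda\in\mathbb C^*$, $\alpha\in\mathbb C$, $h\in\mathbb C[t]$ let $\Omega(\lambda,\alpha,h)=\mathbb C[t,s]$ with $c$ acting as $0$ and $$d_m\big(f(t)s^i\big)=\lambda^m(s-m)^i\Big(\Big(s+mh(t)-m(m-1)\alpha\tfrac{h(t)-h(\alpha)}{t-\alpha}\Big)f(t)-m(t-m\alpha)f'(t)\Big).$$ Let $V$ be an irreducible $\mathrm{Vir}$-module on which $d_n$ acts locally finitely for all sufficiently large $n$. **Theorem 4.2.** Let $X$ be $\Omega(\lambda,\alpha,h)$ or $\Omega(\lambda,\alpha,h)\otimes V$, and suppose that $X$ is irreducible. Then $X$ is not isomorphic to any of the following $\mathrm{Vir}$-modules. 1. (MZ2) $\mathrm{Ind}_\theta(N)=\mathrm{Ind}(N)/(c-\theta)\mathrm{Ind}(N)$, where $\theta\in\mathbb C$, $\mathrm{Ind}(N)=U(\mathrm{Vir})\otimes_{U(\mathrm{Vir}_+)}N$,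 $\mathrm{Vir}_+=\mathrm{span}\{d_i: i\ge 0\}$, and $N$ is an irreducible $\mathrm{Vir}_+$-module such that for some integer $k\ge1$ the element $d_k$ acts injectively on $N$ and $d_iN=0$ for all $i>k$; an irreducible highest weight module $V(\theta,\eta)$, $\theta,\eta\in\mathbb C$ (the quotient of the Verma module with $c=\theta$, $d_0=\eta$ on the highest weight vector, by its unique maximal proper submodule); or, more generally, any irreducible $\mathrm{Vir}$-module on which $d_n$ acts locally finitely for all sufficiently large $n$. 2. (LZ1) $A_b$, where $b\in\mathbb C$ and $A$ is an irreducible module over the algebra $\mathbb C[t,t^{-1},D]$, $D=t\frac{d}{dt}$, of differential operators; $A_b=A$ as a space, with $d_m w=(t^mD+mb\,t^m)w$ and $c\,w=0$. 3. (LLZ) $\mathcal N(M,\beta)=M\otimes\mathbb C[t,t^{-1}]$, where $\beta\in\mathbb C[t,t^{-1}]$, $k\ge1$, and $M$ is an irreducible module over $\mathfrak a_k=\mathrm{Vir}_+/\mathrm{span}\{d_i: i>k\}$ on which the image $\bar d_k$ of $d_k$ acts injectively; $c$ acts as $0$ and $$d_m(v\otimes t^n)=\Big(n+\sum_{i=0}^k\frac{m^{i+1}}{(i+1)!}\bar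 d_i\Big)v\otimes t^{n+m}+v\otimes\beta t^{m+n}.$$ 4. (TZ2) $\Omega(\mu_1,b_1)\otimes\cdots\otimes\Omega(\mu_k,b_k)\otimes W$, where $k\ge1$, $\mu_1,\dots,\mu_k\in\mathbb C^*$ are distinct, $b_1,\dots,b_k\in\mathbb C^*$, and $W$ is a $\mathrm{Vir}$-module on which $d_n$ acts locally finitely for all sufficiently large $n$; here $\Omega(\mu,b)=\mathbb C[s]$ with $c$ acting as $0$ and $d_mf(s)=\mu^m(s+mb)f(s-m)$. -/

import Mathlib

open scoped TensorProduct Polynomial LaurentPolynomial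

universe u v

/-! ## The Virasoro algebra -/

/-- The underlying vector space of the Virasoro algebra: the pair `(a, z)` stands for
`∑ i, a i • d i + z • c`. -/
def Vir : Type := (ℤ →₀ ℂ) × ℂ

namespace Vir

noncomputable instance : AddCommGroup Vir := inferInstanceAs (AddCommGroup ((ℤ →₀ ℂ) × ℂ))

noncomputable instance : Module ℂ Vir := inferInstanceAs (Module ℂ ((ℤ →₀ ℂ) × ℂ))

/-- The basis vector `d i`. -/
noncomputable def d (i : ℤ) : Vir := (Finsupp.single i 1, 0)

/-- The central basis vector `c`. -/
noncomputable def c : Vir := (0, 1)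

/-- The projection of the Virasoro algebra to the span of the `d i`. -/
noncomputable def dPart : Vir →ₗ[ℂ] (ℤ →₀ ℂ) := LinearMap.fst ℂ (ℤ →₀ ℂ) ℂ

/-- The value of the bracket on two basis vectors `d i` and `d j`. -/
noncomputable def structureConst (i j : ℤ) : Vir :=
  ((j : ℂ) - i) • d (i + j) + (if i = -j then ((i : ℂ) ^ 3 - i) / 12 else 0) • c

/-- The bilinear extension of `structureConst`, on the span of the `d i`. -/
noncomputable def bracketAux : (ℤ →₀ ℂ) →ₗ[ℂ] (ℤ →₀ ℂ) →ₗ[ℂ] Vir :=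
  Finsupp.linearCombination ℂ fun i => Finsupp.linearCombination ℂ fun j => structureConst i j

/-- The bracket of the Virasoro algebra; `c` is central. -/
noncomputable def bracketBilin : Vir →ₗ[ℂ] Vir →ₗ[ℂ] Vir :=
  bracketAux.compl₁₂ dPart dPart

theorem dPart_d (i : ℤ) : dPart (d i) = Finsupp.single i 1 := rfl

theorem dPart_c : dPart c = 0 := rfl

theorem bracketBilin_d_d (i j : ℤ) : bracketBilin (d i) (d j) = structureConst i j := by
  simp [bracketBilin, bracketAux, dPart_d]

theorem bracketBilin_c_left (x : Vir) : bracketBilin c x = 0 := by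
  simp [bracketBilin, dPart_c]

theorem bracketBilin_c_right (x : Vir) : bracketBilin x c = 0 := by
  simp [bracketBilin, dPart_c]

/-- Every element is a linear combination of the `d i` and `c`. -/
theorem induction {P : Vir → Prop} (x : Vir) (hd : ∀ i, P (d i)) (hc : P c)
    (hadd : ∀ x y, P x → P y → P (x + y)) (hsmul : ∀ (a : ℂ) x, P x → P (a • x)) : P x := by
  have h0 : P 0 := by simpa using hsmul 0 c hc
  have h1 : ∀ a : ℤ →₀ ℂ, P ((a, 0) : (ℤ →₀ ℂ) × ℂ) := by
    intro a
    induction a using Finsupp.induction_linear with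
    | zero => exact h0
    | add f g hf hg =>
      have h := hadd _ _ hf hg
      have e : ((f + g, 0) : (ℤ →₀ ℂ) × ℂ) = (f, 0) + (g, 0) := by simp
      rw [e]; exact h
    | single i b =>
      have h := hsmul b _ (hd i)
      have e : ((Finsupp.single i b, 0) : (ℤ →₀ ℂ) × ℂ) = b • (Finsupp.single i 1, 0) := by simp
      rw [e]; exact h
  have h2 := hadd _ _ (h1 x.1) (hsmul x.2 _ hc)
  have e : x = ((x.1, 0) : (ℤ →₀ ℂ) × ℂ) + x.2 • ((0, 1) : (ℤ →₀ ℂ) × ℂ) := by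
    apply Prod.ext <;> simp
  rw [e]; exact h2

theorem bracketBilin_skew (x y : Vir) : bracketBilin x y = -bracketBilin y x := by
  induction x using Vir.induction with
  | hc => simp [bracketBilin_c_left, bracketBilin_c_right]
  | hadd x x' hx hx' => rw [map_add, LinearMap.add_apply, hx, hx', map_add]; abel
  | hsmul a x hx => rw [map_smul, LinearMap.smul_apply, hx, map_smul, smul_neg]
  | hd i =>
    induction y using Vir.induction with
    | hc => simp [bracketBilin_c_left, bracketBilin_c_right]
    | hadd y y' hy hy' => rw [map_add, hy, hy', map_add, LinearMap.add_apply]; abel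
    | hsmul a y hy => rw [map_smul, hy, map_smul, LinearMap.smul_apply, smul_neg]
    | hd j =>
      rw [bracketBilin_d_d, bracketBilin_d_d, structureConst, structureConst, add_comm j i]
      by_cases h : i = -j
      · have h' : j = -i := by omega
        rw [if_pos h, if_pos h', h]
        push_cast
        module
      · have h' : ¬ j = -i := by omega
        rw [if_neg h, if_neg h']
        module

theorem bracketBilin_jacobi (x y z : Vir) :
    bracketBilin x (bracketBilin y z) =
      bracketBilin (bracketBilin x y) z + bracketBilin y (bracketBilin x z) := by
  induction x using Vir.induction with
  | hc => simp [bracketBilin_c_left]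
  | hadd x x' hx hx' => simp only [map_add, LinearMap.add_apply, hx, hx']; abel
  | hsmul a x hx => simp only [map_smul, LinearMap.smul_apply, hx, smul_add]
  | hd i =>
    induction y using Vir.induction with
    | hc => simp [bracketBilin_c_left, bracketBilin_c_right]
    | hadd y y' hy hy' => simp only [map_add, LinearMap.add_apply, hy, hy']; abel
    | hsmul a y hy => simp only [map_smul, LinearMap.smul_apply, hy, smul_add]
    | hd j =>
      induction z using Vir.induction with
      | hc => simp [bracketBilin_c_right]
      | hadd z z' hz hz' => simp only [map_add, hz, hz']; abel
      | hsmul a z hz => simp only [map_smul, hz, smul_add]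
      | hd k =>
        simp only [bracketBilin_d_d, structureConst, map_add, map_smul, LinearMap.add_apply,
          LinearMap.smul_apply, bracketBilin_c_left, bracketBilin_c_right, smul_zero, add_zero]
        rw [show j + (i + k) = i + (j + k) by ring, show i + j + k = i + (j + k) by ring]
        by_cases h : i + j + k = 0
        · obtain rfl : k = -(i + j) := by omega
          rw [if_pos (by ring), if_pos (by ring), if_pos (by ring)]
          push_cast
          module
        · rw [if_neg (by omega), if_neg (by omega), if_neg (by omega)]
          push_cast
          module

noncomputable instance : LieRing Vir where
  bracket x y := bracketBilin x y
  add_lie x y z := by simp only [map_add, LinearMap.add_apply]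
  lie_add x y z := by simp only [map_add]
  lie_self x := by
    have h := bracketBilin_skew x x
    have h2 : (2 : ℂ) • bracketBilin x x = 0 := by
      rw [two_smul]; nth_rewrite 1 [h]; simp
    exact (smul_eq_zero.mp h2).resolve_left two_ne_zero
  leibniz_lie x y z := bracketBilin_jacobi x y z

noncomputable instance : LieAlgebra ℂ Vir where
  lie_smul a x y := map_smul (bracketBilin x) a y

theorem lie_d_d (i j : ℤ) :
    ⁅d i, d j⁆ = ((j : ℂ) - i) • d (i + j) +
      (if i = -j then ((i : ℂ) ^ 3 - i) / 12 else 0) • c :=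
  bracketBilin_d_d i j

theorem lie_c_left (x : Vir) : ⁅c, x⁆ = 0 := bracketBilin_c_left x

end Vir

/-! ## Constructing modules -/

section Constructions

variable {L X : Type*} [LieRing L] [LieAlgebra ℂ L] [AddCommGroup X] [Module ℂ X]

/-- The module structure given by a linear map `ρ` to the endomorphisms that takes brackets to
commutators. -/
@[reducible] def lieRingModuleOfRep (ρ : L →ₗ[ℂ] Module.End ℂ X)
    (hρ : ∀ x y, ρ ⁅x, y⁆ = ρ x * ρ y - ρ y * ρ x) : LieRingModule L X where
  bracket x m := ρ x m
  add_lie x y m := by simp only [map_add, LinearMap.add_apply]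
  lie_add x m n := map_add (ρ x) m n
  leibniz_lie x y m := by
    simp only [hρ, LinearMap.sub_apply, Module.End.mul_apply]; abel

theorem lieModuleOfRep (ρ : L →ₗ[ℂ] Module.End ℂ X)
    (hρ : ∀ x y, ρ ⁅x, y⁆ = ρ x * ρ y - ρ y * ρ x) :
    @LieModule ℂ L X _ _ _ _ _ (lieRingModuleOfRep ρ hρ) :=
  letI := lieRingModuleOfRep ρ hρ
  { smul_lie := fun a x m => by
      change ρ (a • x) m = a • ρ x m
      simp only [map_smul, LinearMap.smul_apply]
    lie_smul := fun a x m => map_smul (ρ x) a m }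

/-- The linear map on the Virasoro algebra with `d m ↦ D m` and `c ↦ 0`. -/
noncomputable def chargelessRep (D : ℤ → Module.End ℂ X) : Vir →ₗ[ℂ] Module.End ℂ X :=
  (Finsupp.linearCombination ℂ D).comp Vir.dPart

theorem chargelessRep_d (D : ℤ → Module.End ℂ X) (m : ℤ) : chargelessRep D (Vir.d m) = D m := by
  simp [chargelessRep, Vir.dPart_d]

theorem chargelessRep_c (D : ℤ → Module.End ℂ X) : chargelessRep D Vir.c = 0 := by
  simp [chargelessRep, Vir.dPart_c]

theorem chargelessRep_lie (D : ℤ → Module.End ℂ X)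
    (hD : ∀ m n : ℤ, D m * D n - D n * D m = ((n : ℂ) - m) • D (m + n)) (x y : Vir) :
    chargelessRep D ⁅x, y⁆ =
      chargelessRep D x * chargelessRep D y - chargelessRep D y * chargelessRep D x := by
  induction x using Vir.induction with
  | hc => simp [Vir.lie_c_left, chargelessRep_c]
  | hadd x x' hx hx' => rw [add_lie, map_add, map_add, hx, hx', add_mul, mul_add]; abel
  | hsmul a x hx =>
    rw [smul_lie, map_smul, map_smul, hx, smul_sub, smul_mul_assoc, mul_smul_comm]
  | hd i =>
    induction y using Vir.induction with
    | hc =>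
      rw [← lie_skew, Vir.lie_c_left, chargelessRep_c]; simp
    | hadd y y' hy hy' => rw [lie_add, map_add, map_add, hy, hy', add_mul, mul_add]; abel
    | hsmul a y hy =>
      rw [lie_smul, map_smul, map_smul, hy, smul_sub, smul_mul_assoc, mul_smul_comm]
    | hd j =>
      rw [Vir.lie_d_d, map_add, map_smul, map_smul, chargelessRep_c, chargelessRep_d,
        chargelessRep_d, chargelessRep_d, hD]
      simp

end Constructions

/-! ## The modules `Ω(λ, α, h)` -/

namespace Omega

/-- The polynomial `(h(t) - h(α)) / (t - α)`. -/
noncomputable def divDiff (α : ℂ) (h : ℂ[X]) : ℂ[X] :=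
  (h - Polynomial.C (h.eval α)) /ₘ (Polynomial.X - Polynomial.C α)

/-- The operator
`f ↦ (m h(t) - m (m - 1) α (h(t) - h(α)) / (t - α)) f(t) - m (t - m α) f'(t)` on `ℂ[t]`. -/
noncomputable def coeffOp (α : ℂ) (h : ℂ[X]) (m : ℤ) : ℂ[X] →ₗ[ℂ] ℂ[X] :=
  LinearMap.mulLeft ℂ
      (Polynomial.C (m : ℂ) * h - Polynomial.C ((m : ℂ) * (m - 1) * α) * divDiff α h) -
    LinearMap.mulLeft ℂ
        (Polynomial.C (m : ℂ) * (Polynomial.X - Polynomial.C ((m : ℂ) * α))) ∘ₗ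
      Polynomial.derivative

/-- The action of `d m` on `ℂ[t, s]`, viewed as `ℂ[t][s]`: it sends `f(t) s ^ i` to
`λ ^ m (s - m) ^ i (s f + coeffOp f)`. -/
noncomputable def op (lam : ℂˣ) (α : ℂ) (h : ℂ[X]) (m : ℤ) : Module.End ℂ ℂ[X][X] :=
  Polynomial.lsum fun i =>
    LinearMap.mulLeft ℂ
        (Polynomial.C (Polynomial.C ((lam : ℂ) ^ m)) *
          (Polynomial.X - Polynomial.C (Polynomial.C (m : ℂ))) ^ i) ∘ₗ
      (LinearMap.mulLeft ℂ (Polynomial.X : ℂ[X][X]) ∘ₗ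
          (Polynomial.CAlgHom (R := ℂ) (A := ℂ[X])).toLinearMap +
        (Polynomial.CAlgHom (R := ℂ) (A := ℂ[X])).toLinearMap ∘ₗ coeffOp α h m)

/-- The defining formula of the action. -/
theorem op_monomial (lam : ℂˣ) (α : ℂ) (h : ℂ[X]) (m : ℤ) (i : ℕ) (f : ℂ[X]) :
    op lam α h m (Polynomial.C f * Polynomial.X ^ i) =
      Polynomial.C (Polynomial.C ((lam : ℂ) ^ m)) *
        (Polynomial.X - Polynomial.C (Polynomial.C (m : ℂ))) ^ i *
        (Polynomial.X * Polynomial.C f +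
          Polynomial.C ((Polynomial.C (m : ℂ) * h -
              Polynomial.C ((m : ℂ) * (m - 1) * α) *
                ((h - Polynomial.C (h.eval α)) /ₘ (Polynomial.X - Polynomial.C α))) * f -
            Polynomial.C (m : ℂ) * (Polynomial.X - Polynomial.C ((m : ℂ) * α)) *
              Polynomial.derivative f)) := by
  rw [Polynomial.C_mul_X_pow_eq_monomial, op, Polynomial.lsum_apply,
    Polynomial.sum_monomial_index _ _ (by simp)]
  simp [coeffOp, divDiff]
  ring

theorem op_X_mul (lam : ℂˣ) (α : ℂ) (h : ℂ[X]) (m : ℤ) (p : ℂ[X][X]) :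
    op lam α h m (Polynomial.X * p) =
      (Polynomial.X - Polynomial.C (Polynomial.C (m : ℂ))) * op lam α h m p := by
  induction p using Polynomial.induction_on' with
  | add p q hp hq => rw [mul_add, map_add, hp, hq, map_add, mul_add]
  | monomial i f =>
    rw [← Polynomial.C_mul_X_pow_eq_monomial, show Polynomial.X * (Polynomial.C f *
      Polynomial.X ^ i) = Polynomial.C f * Polynomial.X ^ (i + 1) by ring, op_monomial,
      op_monomial]
    ring

theorem op_C_mul (lam : ℂˣ) (α : ℂ) (h : ℂ[X]) (m : ℤ) (a : ℂ) (p : ℂ[X][X]) :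
    op lam α h m (Polynomial.C (Polynomial.C a) * p) =
      Polynomial.C (Polynomial.C a) * op lam α h m p := by
  have e : ∀ q : ℂ[X][X], Polynomial.C (Polynomial.C a) * q = a • q := by
    intro q
    rw [← Polynomial.smul_eq_C_mul, ← algebraMap_smul ℂ[X] a q]
    rfl
  rw [e, e, map_smul]

theorem op_shift_mul (lam : ℂˣ) (α : ℂ) (h : ℂ[X]) (m : ℤ) (a : ℂ) (p : ℂ[X][X]) :
    op lam α h m ((Polynomial.X - Polynomial.C (Polynomial.C a)) * p) =
      (Polynomial.X - Polynomial.C (Polynomial.C (m : ℂ)) - Polynomial.C (Polynomial.C a)) *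
        op lam α h m p := by
  rw [sub_mul, map_sub, op_X_mul, op_C_mul, ← sub_mul]

theorem op_shift_pow_mul (lam : ℂˣ) (α : ℂ) (h : ℂ[X]) (m : ℤ) (a : ℂ) (i : ℕ) (p : ℂ[X][X]) :
    op lam α h m ((Polynomial.X - Polynomial.C (Polynomial.C a)) ^ i * p) =
      (Polynomial.X - Polynomial.C (Polynomial.C (m : ℂ)) - Polynomial.C (Polynomial.C a)) ^ i *
        op lam α h m p := by
  induction i with
  | zero => rw [pow_zero, pow_zero, one_mul, one_mul]
  | succ i ih => rw [pow_succ', mul_assoc, op_shift_mul, ih, pow_succ', mul_assoc]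

theorem op_C (lam : ℂˣ) (α : ℂ) (h : ℂ[X]) (m : ℤ) (f : ℂ[X]) :
    op lam α h m (Polynomial.C f) = Polynomial.C (Polynomial.C ((lam : ℂ) ^ m)) *
      (Polynomial.X * Polynomial.C f + Polynomial.C (coeffOp α h m f)) := by
  have := op_monomial lam α h m 0 f
  rw [pow_zero, pow_zero, mul_one, mul_one] at this
  exact this

theorem coeffOp_comm (α : ℂ) (h : ℂ[X]) (m n : ℤ) (f : ℂ[X]) :
    coeffOp α h m (coeffOp α h n f) - coeffOp α h n (coeffOp α h m f)
      - Polynomial.C (m : ℂ) * coeffOp α h m f + Polynomial.C (n : ℂ) * coeffOp α h n f =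
    Polynomial.C ((n : ℂ) - m) * coeffOp α h (m + n) f := by
  have hh : h = Polynomial.C (h.eval α) +
      (Polynomial.X - Polynomial.C α) * divDiff α h := by
    have h1 := Polynomial.modByMonic_add_div (h - Polynomial.C (h.eval α))
      (Polynomial.X - Polynomial.C α)
    rw [Polynomial.modByMonic_X_sub_C_eq_C_eval] at h1
    simp only [Polynomial.eval_sub, Polynomial.eval_C, sub_self, Polynomial.C_0, zero_add] at h1
    rw [divDiff, h1]; ring
  have hh' : Polynomial.derivative h = divDiff α h +
      (Polynomial.X - Polynomial.C α) * Polynomial.derivative (divDiff α h) := by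
    conv_lhs => rw [hh]
    simp
  simp only [coeffOp, LinearMap.sub_apply, LinearMap.comp_apply, LinearMap.mulLeft_apply,
    map_sub, Polynomial.derivative_mul, Polynomial.derivative_C, Polynomial.derivative_X,
    zero_mul, zero_add, sub_zero, hh', Polynomial.C_mul,
    Polynomial.C_add, Int.cast_add, Polynomial.C_1,
    Polynomial.derivative_one]
  generalize Polynomial.derivative (divDiff α h) = q' at *
  generalize divDiff α h = q at *
  generalize h.eval α = e at *
  subst hh
  ring

theorem op_comm (lam : ℂˣ) (α : ℂ) (h : ℂ[X]) (m n : ℤ) :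
    op lam α h m * op lam α h n - op lam α h n * op lam α h m =
      ((n : ℂ) - m) • op lam α h (m + n) := by
  have key : ∀ (m n : ℤ) (i : ℕ) (f : ℂ[X]), op lam α h m (op lam α h n
      (Polynomial.X ^ i * Polynomial.C f)) = Polynomial.C (Polynomial.C ((lam : ℂ) ^ (m + n))) *
        (Polynomial.X - Polynomial.C (Polynomial.C (m : ℂ))
          - Polynomial.C (Polynomial.C (n : ℂ))) ^ i *
        ((Polynomial.X - Polynomial.C (Polynomial.C (m : ℂ))) *
          (Polynomial.X * Polynomial.C f + Polynomial.C (coeffOp α h m f)) +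
          (Polynomial.X * Polynomial.C (coeffOp α h n f) +
            Polynomial.C (coeffOp α h m (coeffOp α h n f)))) := by
    intro m n i f
    have e0 : (Polynomial.X ^ i : ℂ[X][X]) =
        (Polynomial.X - Polynomial.C (Polynomial.C 0)) ^ i := by simp
    rw [e0, op_shift_pow_mul, op_C]
    rw [show (Polynomial.X - Polynomial.C (Polynomial.C (n : ℂ)) -
      Polynomial.C (Polynomial.C 0) : ℂ[X][X]) = Polynomial.X - Polynomial.C (Polynomial.C (n : ℂ))
      by simp]
    rw [op_shift_pow_mul, op_C_mul, map_add, op_X_mul, op_C, op_C,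
      zpow_add₀ lam.ne_zero, Polynomial.C_mul, Polynomial.C_mul]
    ring
  apply LinearMap.ext
  intro p
  induction p using Polynomial.induction_on' with
  | add p q hp hq => rw [map_add, hp, hq, map_add]
  | monomial i f =>
    rw [← Polynomial.C_mul_X_pow_eq_monomial, LinearMap.sub_apply, LinearMap.smul_apply,
      Module.End.mul_apply, Module.End.mul_apply, mul_comm (Polynomial.C f), key, key, add_comm n m,
      ← sub_zero ((Polynomial.X : ℂ[X][X]) ^ i)]
    have e0 : (Polynomial.X ^ i - 0 : ℂ[X][X]) =
        (Polynomial.X - Polynomial.C (Polynomial.C 0)) ^ i := by simp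
    have e : ∀ (a : ℂ) (q : ℂ[X][X]), a • q = Polynomial.C (Polynomial.C a) * q := by
      intro a q
      rw [← Polynomial.smul_eq_C_mul, ← algebraMap_smul ℂ[X] a q]
      rfl
    rw [e0, op_shift_pow_mul, op_C, e]
    have hc := congrArg (Polynomial.C : ℂ[X] → ℂ[X][X]) (coeffOp_comm α h m n f)
    simp only [map_sub, map_add, map_mul, Polynomial.C_0, sub_zero, Int.cast_add] at hc ⊢
    linear_combination (Polynomial.C (Polynomial.C ((lam : ℂ) ^ (m + n))) *
        (Polynomial.X - Polynomial.C (Polynomial.C (m : ℂ))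
          - Polynomial.C (Polynomial.C (n : ℂ))) ^ i) * hc

end Omega

/-- The space `ℂ[t, s] = ℂ[t][s]` underlying the module `Ω(λ, α, h)`. -/
def Omega (_lam : ℂˣ) (_α : ℂ) (_h : ℂ[X]) : Type := ℂ[X][X]

namespace Omega

variable (lam : ℂˣ) (α : ℂ) (h : ℂ[X])

noncomputable instance : AddCommGroup (Omega lam α h) := inferInstanceAs (AddCommGroup ℂ[X][X])

noncomputable instance : Module ℂ (Omega lam α h) := inferInstanceAs (Module ℂ ℂ[X][X])

/-- The representation `d m ↦ op m`, `c ↦ 0`. -/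
noncomputable def rep : Vir →ₗ[ℂ] Module.End ℂ (Omega lam α h) := chargelessRep (op lam α h)

noncomputable instance : LieRingModule Vir (Omega lam α h) :=
  lieRingModuleOfRep (rep lam α h) (chargelessRep_lie _ (op_comm lam α h))

instance : LieModule ℂ Vir (Omega lam α h) :=
  lieModuleOfRep (rep lam α h) (chargelessRep_lie _ (op_comm lam α h))

end Omega


/-! ## The modules `Ω(μ, b)` -/

namespace OmegaOne

/-- The operator `f(s) ↦ μ ^ m (s + m b) f(s - m)` on `ℂ[s]`. -/
noncomputable def op (mu : ℂˣ) (b : ℂ) (m : ℤ) : Module.End ℂ ℂ[X] where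
  toFun f := Polynomial.C ((mu : ℂ) ^ m) * (Polynomial.X + Polynomial.C ((m : ℂ) * b)) *
    f.comp (Polynomial.X - Polynomial.C (m : ℂ))
  map_add' f g := by rw [Polynomial.add_comp, mul_add]
  map_smul' a f := by
    rw [Polynomial.smul_comp, mul_smul_comm, RingHom.id_apply]

theorem op_comm (mu : ℂˣ) (b : ℂ) (m n : ℤ) :
    op mu b m * op mu b n - op mu b n * op mu b m = ((n : ℂ) - m) • op mu b (m + n) := by
  have key : ∀ (m n : ℤ) (f : ℂ[X]), op mu b m (op mu b n f) =
      Polynomial.C ((mu : ℂ) ^ (m + n)) * (Polynomial.X + Polynomial.C ((m : ℂ) * b)) *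
        (Polynomial.X - Polynomial.C (m : ℂ) + Polynomial.C ((n : ℂ) * b)) *
        f.comp (Polynomial.X - Polynomial.C ((m + n : ℤ) : ℂ)) := by
    intro m n f
    have e : (Polynomial.X - Polynomial.C (n : ℂ)).comp (Polynomial.X - Polynomial.C (m : ℂ)) =
        Polynomial.X - Polynomial.C ((m + n : ℤ) : ℂ) := by
      rw [Polynomial.sub_comp, Polynomial.X_comp, Polynomial.C_comp, Int.cast_add,
        Polynomial.C_add]
      ring
    simp only [op, LinearMap.coe_mk, AddHom.coe_mk, Polynomial.mul_comp, Polynomial.add_comp,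
      Polynomial.C_comp, Polynomial.X_comp, Polynomial.comp_assoc, e]
    simp only [zpow_add₀ mu.ne_zero, Polynomial.C_mul]
    ring
  apply LinearMap.ext
  intro f
  rw [LinearMap.sub_apply, LinearMap.smul_apply, Module.End.mul_apply, Module.End.mul_apply,
    key, key, add_comm n m, Polynomial.smul_eq_C_mul]
  simp only [op, LinearMap.coe_mk, AddHom.coe_mk, Polynomial.C_mul, Polynomial.C_sub,
    Polynomial.C_add, Int.cast_add]
  ring

end OmegaOne

/-- The space `ℂ[s]` underlying the module `Ω(μ, b)`. -/
def OmegaOne (_mu : ℂˣ) (_b : ℂ) : Type := ℂ[X]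

namespace OmegaOne

variable (mu : ℂˣ) (b : ℂ)

noncomputable instance : AddCommGroup (OmegaOne mu b) := inferInstanceAs (AddCommGroup ℂ[X])

noncomputable instance : Module ℂ (OmegaOne mu b) := inferInstanceAs (Module ℂ ℂ[X])

/-- The representation `d m ↦ op m`, `c ↦ 0`. -/
noncomputable def rep : Vir →ₗ[ℂ] Module.End ℂ (OmegaOne mu b) := chargelessRep (op mu b)

noncomputable instance : LieRingModule Vir (OmegaOne mu b) :=
  lieRingModuleOfRep (rep mu b) (chargelessRep_lie _ (op_comm mu b))

instance : LieModule ℂ Vir (OmegaOne mu b) :=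
  lieModuleOfRep (rep mu b) (chargelessRep_lie _ (op_comm mu b))

end OmegaOne

/-! ## Tensor products of finite families of modules -/

namespace PiTensorLie

variable {ι : Type*} [DecidableEq ι] {L : Type*} [LieRing L] [LieAlgebra ℂ L]
  {M : ι → Type*} [∀ i, AddCommGroup (M i)] [∀ i, Module ℂ (M i)]
  [∀ i, LieRingModule L (M i)] [∀ i, LieModule ℂ L (M i)]

/-- An operator on one factor, acting on the whole tensor product. -/
noncomputable def factorOp (i : ι) : Module.End ℂ (M i) →ₗ[ℂ] Module.End ℂ (⨂[ℂ] i, M i) where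
  toFun f := PiTensorProduct.map (Function.update (fun _ => LinearMap.id) i f)
  map_add' f g := PiTensorProduct.map_update_add _ i f g
  map_smul' a f := PiTensorProduct.map_update_smul _ i a f

theorem factorOp_mul (i : ι) (f g : Module.End ℂ (M i)) :
    factorOp i (f * g) = factorOp i f * factorOp i g := by
  change PiTensorProduct.map _ = PiTensorProduct.map _ * PiTensorProduct.map _
  rw [← PiTensorProduct.map_mul]
  congr 1
  ext1 j
  by_cases hj : j = i
  · subst hj; simp
  · simp only [Function.update_of_ne hj]; rfl

theorem factorOp_comm {i j : ι} (hij : i ≠ j) (f : Module.End ℂ (M i)) (g : Module.End ℂ (M j)) :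
    factorOp i f * factorOp j g = factorOp j g * factorOp i f := by
  change PiTensorProduct.map _ * PiTensorProduct.map _ =
    PiTensorProduct.map _ * PiTensorProduct.map _
  rw [← PiTensorProduct.map_mul, ← PiTensorProduct.map_mul]
  congr 1
  ext1 l
  by_cases hl : l = i
  · subst hl
    simp only [Function.update_self, Function.update_of_ne hij]; rfl
  · simp only [Function.update_of_ne hl]; rfl

variable [Fintype ι]

/-- `x` acts on a pure tensor as the sum over the factors of its action on that factor. -/
noncomputable def rep : L →ₗ[ℂ] Module.End ℂ (⨂[ℂ] i, M i) :=
  ∑ i, factorOp i ∘ₗ (LieModule.toEnd ℂ L (M i) : L →ₗ[ℂ] Module.End ℂ (M i))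

theorem rep_apply (x : L) :
    rep (M := M) x = ∑ i, factorOp i (LieModule.toEnd ℂ L (M i) x) := by
  simp [rep]

theorem rep_lie (x y : L) :
    rep (M := M) ⁅x, y⁆ = rep x * rep y - rep y * rep x := by
  simp only [rep_apply, Finset.sum_mul_sum]
  rw [Finset.sum_comm (f := fun i j => factorOp i (LieModule.toEnd ℂ L (M i) y) *
    factorOp j (LieModule.toEnd ℂ L (M j) x)), ← Finset.sum_sub_distrib]
  refine Finset.sum_congr rfl fun i _ => ?_
  rw [← Finset.sum_sub_distrib, Finset.sum_eq_single i]
  · rw [← factorOp_mul, ← factorOp_mul, ← map_sub]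
    congr 1
    ext m
    simp
  · intro j _ hj
    rw [factorOp_comm (Ne.symm hj), sub_self]
  · simp

noncomputable instance : LieRingModule L (⨂[ℂ] i, M i) := lieRingModuleOfRep rep rep_lie

instance : LieModule ℂ L (⨂[ℂ] i, M i) := lieModuleOfRep rep rep_lie

end PiTensorLie

/-! ## The modules `A_b` -/

/-- The derivation `t d/dt` of `ℂ[t, t⁻¹]`. -/
noncomputable def laurentD : Module.End ℂ ℂ[T;T⁻¹] :=
  (Finsupp.linearCombination ℂ fun n : ℤ => (n : ℂ) • (LaurentPolynomial.T n : ℂ[T;T⁻¹])) ∘ₗ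
    (AddMonoidAlgebra.coeffLinearEquiv ℂ).toLinearMap

/-- Multiplication by a Laurent polynomial. -/
noncomputable def laurentMul (p : ℂ[T;T⁻¹]) : Module.End ℂ ℂ[T;T⁻¹] := LinearMap.mulLeft ℂ p

theorem laurentD_T (n : ℤ) :
    laurentD (LaurentPolynomial.T n) = (n : ℂ) • LaurentPolynomial.T n := by
  change Finsupp.linearCombination ℂ (fun n : ℤ => (n : ℂ) • (LaurentPolynomial.T n : ℂ[T;T⁻¹]))
    (Finsupp.single n 1) = _
  rw [Finsupp.linearCombination_single, one_smul]

theorem laurentMul_mul (p q : ℂ[T;T⁻¹]) : laurentMul p * laurentMul q = laurentMul (p * q) :=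
  LinearMap.ext fun f => (mul_assoc p q f).symm

theorem laurentMul_apply (p q : ℂ[T;T⁻¹]) : laurentMul p q = p * q := rfl

theorem laurent_ext {f g : Module.End ℂ ℂ[T;T⁻¹]}
    (h : ∀ n : ℤ, f (LaurentPolynomial.T n) = g (LaurentPolynomial.T n)) : f = g := by
  apply LinearMap.ext
  intro p
  induction p using LaurentPolynomial.induction_on' with
  | add p q hp hq => rw [map_add, hp, hq, map_add]
  | C_mul_T n a => rw [← LaurentPolynomial.smul_eq_C_mul, map_smul, h, map_smul]

theorem laurentD_mul (m : ℤ) :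
    laurentD * laurentMul (LaurentPolynomial.T m) =
      laurentMul (LaurentPolynomial.T m) * laurentD +
        (m : ℂ) • laurentMul (LaurentPolynomial.T m) := by
  refine laurent_ext fun n => ?_
  rw [LinearMap.add_apply, LinearMap.smul_apply, Module.End.mul_apply, Module.End.mul_apply,
    laurentMul_apply, laurentMul_apply, laurentD_T, mul_smul_comm, ← LaurentPolynomial.T_add,
    laurentD_T]
  push_cast
  module

/-- The algebra `ℂ[t, t⁻¹, t d/dt]` of differential operators on `ℂ[t, t⁻¹]`. -/
noncomputable abbrev DiffOp : Subalgebra ℂ (Module.End ℂ ℂ[T;T⁻¹]) :=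
  Algebra.adjoin ℂ (insert laurentD (Set.range laurentMul))

namespace DiffOp

/-- `t ^ m` as a differential operator. -/
noncomputable def t (m : ℤ) : DiffOp :=
  ⟨laurentMul (LaurentPolynomial.T m), Algebra.subset_adjoin (Or.inr ⟨_, rfl⟩)⟩

/-- `t d/dt` as a differential operator. -/
noncomputable def D : DiffOp := ⟨laurentD, Algebra.subset_adjoin (Or.inl rfl)⟩

/-- The differential operator `t ^ m D + m b t ^ m`. -/
noncomputable def vect (b : ℂ) (m : ℤ) : DiffOp := t m * D + ((m : ℂ) * b) • t m

theorem t_mul (m n : ℤ) : t m * t n = t (m + n) := by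
  apply Subtype.ext
  change laurentMul _ * laurentMul _ = laurentMul _
  rw [laurentMul_mul, LaurentPolynomial.T_add]

theorem D_mul (m : ℤ) : D * t m = t m * D + (m : ℂ) • t m := Subtype.ext (laurentD_mul m)

theorem vect_comm (b : ℂ) (m n : ℤ) :
    vect b m * vect b n - vect b n * vect b m = ((n : ℂ) - m) • vect b (m + n) := by
  have key : ∀ m n : ℤ, vect b m * vect b n =
      t (m + n) * D * D + ((n : ℂ) + (m + n) * b) • (t (m + n) * D) +
        ((n : ℂ) * n * b + m * n * b * b) • t (m + n) := by
    intro m n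
    have e1 : t m * D * (t n * D) = t (m + n) * D * D + (n : ℂ) • (t (m + n) * D) := by
      rw [mul_assoc, ← mul_assoc D, D_mul, add_mul, mul_add, smul_mul_assoc, mul_smul_comm,
        ← mul_assoc, ← mul_assoc, t_mul]
    have e2 : t m * D * t n = t (m + n) * D + (n : ℂ) • t (m + n) := by
      rw [mul_assoc, D_mul, mul_add, mul_smul_comm, ← mul_assoc, t_mul]
    rw [vect, vect, add_mul, mul_add, mul_add, mul_smul_comm, smul_mul_assoc, smul_mul_assoc,
      mul_smul_comm, e1, e2, t_mul, ← mul_assoc, t_mul]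
    module
  rw [key, key, add_comm n m, vect]
  push_cast
  module

end DiffOp

section TwistedWeyl

variable (A : Type*) [AddCommGroup A] [Module ℂ A] [Module DiffOp A] [IsScalarTower ℂ DiffOp A]

/-- The space `A` underlying the module `A_b`. -/
@[nolint unusedArguments]
def TwistedWeyl (_b : ℂ) : Type _ := A

namespace TwistedWeyl

variable (b : ℂ)

instance : AddCommGroup (TwistedWeyl A b) := inferInstanceAs (AddCommGroup A)

instance : Module ℂ (TwistedWeyl A b) := inferInstanceAs (Module ℂ A)

/-- The representation `d m ↦ t ^ m D + m b t ^ m`, `c ↦ 0`. -/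
noncomputable def rep : Vir →ₗ[ℂ] Module.End ℂ A :=
  chargelessRep fun m => Module.toModuleEnd ℂ A (DiffOp.vect b m)

theorem rep_lie (x y : Vir) : rep A b ⁅x, y⁆ = rep A b x * rep A b y - rep A b y * rep A b x := by
  refine chargelessRep_lie _ (fun m n => ?_) x y
  rw [← map_mul, ← map_mul, ← map_sub, DiffOp.vect_comm]
  ext w
  simp

noncomputable instance : LieRingModule Vir (TwistedWeyl A b) :=
  lieRingModuleOfRep (X := A) (rep A b) (rep_lie A b)

instance : LieModule ℂ Vir (TwistedWeyl A b) :=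
  lieModuleOfRep (X := A) (rep A b) (rep_lie A b)

end TwistedWeyl

end TwistedWeyl

/-! ## The subalgebra `Vir₊` and the Lie algebras `𝔞_k` -/

/-- The subalgebra of the Virasoro algebra spanned by the `d i` with `i ≥ 0`. -/
noncomputable def VirPlus : LieSubalgebra ℂ Vir where
  __ := Submodule.span ℂ (Set.range fun i : ℕ => Vir.d i)
  lie_mem' := by
    intro x y hx hy
    have hx' : x ∈ Submodule.span ℂ (Set.range fun i : ℕ => Vir.d i) := hx
    have hy' : y ∈ Submodule.span ℂ (Set.range fun i : ℕ => Vir.d i) := hy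
    change ⁅x, y⁆ ∈ Submodule.span ℂ (Set.range fun i : ℕ => Vir.d i)
    clear hx hy
    induction hx' using Submodule.span_induction with
    | zero => rw [zero_lie]; exact Submodule.zero_mem _
    | add x x' _ _ h h' => rw [add_lie]; exact Submodule.add_mem _ h h'
    | smul a x _ h => rw [smul_lie]; exact Submodule.smul_mem _ _ h
    | mem x hx =>
      obtain ⟨i, rfl⟩ := hx
      induction hy' using Submodule.span_induction with
      | zero => rw [lie_zero]; exact Submodule.zero_mem _
      | add y y' _ _ h h' => rw [lie_add]; exact Submodule.add_mem _ h h'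
      | smul a y _ h => rw [lie_smul]; exact Submodule.smul_mem _ _ h
      | mem y hy =>
        obtain ⟨j, rfl⟩ := hy
        have e : ⁅Vir.d i, Vir.d j⁆ = (((j : ℤ) : ℂ) - (i : ℤ)) • Vir.d ((i + j : ℕ) : ℤ) := by
          rw [Vir.lie_d_d]
          by_cases hij : (i : ℤ) = -j
          · obtain rfl : i = 0 := by omega
            simp
          · rw [if_neg hij]; simp
        change ⁅Vir.d i, Vir.d j⁆ ∈ _
        rw [e]
        exact Submodule.smul_mem _ _ (Submodule.subset_span ⟨i + j, rfl⟩)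

namespace VirPlus

/-- `d i` as an element of `VirPlus`. -/
noncomputable def d (i : ℕ) : VirPlus := ⟨Vir.d i, Submodule.subset_span ⟨i, rfl⟩⟩

theorem lie_d_d (i j : ℕ) : ⁅d i, d j⁆ = ((j : ℂ) - i) • d (i + j) := by
  apply Subtype.ext
  change ⁅Vir.d i, Vir.d j⁆ = ((j : ℂ) - i) • Vir.d ((i + j : ℕ) : ℤ)
  rw [Vir.lie_d_d]
  by_cases hij : (i : ℤ) = -j
  · obtain rfl : i = 0 := by omega
    simp
  · rw [if_neg hij]; simp

/-- The ideal of `VirPlus` generated by the `d i` with `i > k`. -/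
noncomputable def idealGT (k : ℕ) : LieIdeal ℂ VirPlus :=
  LieSubmodule.lieSpan ℂ VirPlus {x | ∃ i, k < i ∧ x = d i}

end VirPlus

/-- The quotient Lie algebra `𝔞_k` of `VirPlus` by the ideal generated by the `d i`, `i > k`. -/
abbrev TruncVir (k : ℕ) : Type := VirPlus ⧸ VirPlus.idealGT k

namespace TruncVir

/-- The image of `d i` in `𝔞_k`. -/
noncomputable def d (k i : ℕ) : TruncVir k := LieSubmodule.Quotient.mk (VirPlus.d i)

theorem lie_d_d (k i j : ℕ) : ⁅d k i, d k j⁆ = ((j : ℂ) - i) • d k (i + j) := by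
  rw [d, d, ← LieSubmodule.Quotient.mk_bracket, VirPlus.lie_d_d]
  rfl

theorem d_eq_zero (k i : ℕ) (h : k < i) : d k i = 0 := by
  rw [d, LieSubmodule.Quotient.mk_eq_zero']
  exact LieSubmodule.subset_lieSpan ⟨i, h, rfl⟩

end TruncVir

/-! ## The modules `N(M, β)` -/

namespace LoopMod

/-- `x ^ a / a!`. -/
noncomputable def divPow (x : ℂ) (a : ℕ) : ℂ := x ^ a / (a.factorial : ℂ)

theorem sum_divPow (x y : ℂ) (q : ℕ) :
    ∑ p ∈ Finset.HasAntidiagonal.antidiagonal q, divPow x p.1 * divPow y p.2 = divPow (x + y) q := by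
  rw [divPow, (Commute.all x y).add_pow', Finset.sum_div]
  refine Finset.sum_congr rfl fun p hp => ?_
  rw [Finset.HasAntidiagonal.mem_antidiagonal] at hp
  subst hp
  have h1 : ((p.1 + p.2).choose p.1 : ℂ) * (p.1.factorial * p.2.factorial) =
      (p.1 + p.2).factorial := by
    rw [← mul_assoc, Nat.choose_symm_add]
    exact_mod_cast Nat.add_choose_mul_factorial_mul_factorial p.1 p.2
  have h2 : (p.1.factorial : ℂ) ≠ 0 := by exact_mod_cast p.1.factorial_ne_zero
  have h3 : (p.2.factorial : ℂ) ≠ 0 := by exact_mod_cast p.2.factorial_ne_zero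
  have h4 : ((p.1 + p.2).factorial : ℂ) ≠ 0 := by exact_mod_cast (p.1 + p.2).factorial_ne_zero
  rw [nsmul_eq_mul, divPow, divPow, div_mul_div_comm, div_eq_div_iff (mul_ne_zero h2 h3) h4,
    ← h1]
  ring

theorem succ_mul_divPow (x : ℂ) (a : ℕ) : ((a : ℂ) + 1) * divPow x (a + 1) = x * divPow x a := by
  have h2 : (a.factorial : ℂ) ≠ 0 := by exact_mod_cast a.factorial_ne_zero
  have h3 : (a : ℂ) + 1 ≠ 0 := by exact_mod_cast a.succ_ne_zero
  rw [divPow, divPow, Nat.factorial_succ]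
  push_cast
  field_simp
  ring

theorem sum_coeff (x y : ℂ) (p : ℕ) :
    ∑ q ∈ Finset.HasAntidiagonal.antidiagonal p,
        divPow x (q.1 + 1) * divPow y (q.2 + 1) * ((q.2 : ℂ) - q.1) =
      (y - x) * divPow (x + y) (p + 1) + x * divPow x (p + 1) - y * divPow y (p + 1) := by
  have h0 : ∀ z : ℂ, divPow z 0 = 1 := fun z => by simp [divPow]
  have h1 := sum_divPow x y (p + 1)
  have h2 := sum_divPow x y (p + 1)
  rw [Finset.Nat.sum_antidiagonal_succ, h0, one_mul] at h1
  rw [Finset.Nat.sum_antidiagonal_succ', h0, mul_one] at h2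
  have h3 : ∑ q ∈ Finset.HasAntidiagonal.antidiagonal p,
        divPow x (q.1 + 1) * divPow y (q.2 + 1) * ((q.2 : ℂ) - q.1) =
      y * ∑ q ∈ Finset.HasAntidiagonal.antidiagonal p, divPow x (q.1 + 1) * divPow y q.2 -
        x * ∑ q ∈ Finset.HasAntidiagonal.antidiagonal p, divPow x q.1 * divPow y (q.2 + 1) := by
    rw [Finset.mul_sum, Finset.mul_sum, ← Finset.sum_sub_distrib]
    refine Finset.sum_congr rfl fun q _ => ?_
    linear_combination divPow x (q.1 + 1) * succ_mul_divPow y q.2 -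
      divPow y (q.2 + 1) * succ_mul_divPow x q.1
  rw [h3]
  linear_combination y * h1 - x * h2

variable (k : ℕ) (M : Type*) [AddCommGroup M] [Module ℂ M] [LieRingModule (TruncVir k) M]
  [LieModule ℂ (TruncVir k) M]

/-- The operator `∑_{i = 0}^k m ^ (i + 1) / (i + 1)! d_i` on the `𝔞_k`-module `M`. -/
noncomputable def headOp (m : ℤ) : Module.End ℂ M :=
  ∑ i ∈ Finset.range (k + 1),
    ((m : ℂ) ^ (i + 1) / ((i + 1).factorial : ℂ)) •
      LieModule.toEnd ℂ (TruncVir k) M (TruncVir.d k i)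

theorem headOp_comm (m n : ℤ) :
    headOp k M m * headOp k M n - headOp k M n * headOp k M m =
      ((n : ℂ) - m) • headOp k M (m + n) + (m : ℂ) • headOp k M m - (n : ℂ) • headOp k M n := by
  set e : ℕ → Module.End ℂ M := fun i => LieModule.toEnd ℂ (TruncVir k) M (TruncVir.d k i) with he
  have he0 : ∀ p, k < p → e p = 0 := by
    intro p hp
    rw [he]
    simp only [TruncVir.d_eq_zero k p hp, map_zero]
  have hcomm : ∀ i j, e i * e j - e j * e i = ((j : ℂ) - i) • e (i + j) := by
    intro i j
    rw [he]
    simp only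
    rw [← map_smul, ← TruncVir.lie_d_d]
    ext w
    simp
  have hh : ∀ r : ℤ, headOp k M r = ∑ i ∈ Finset.range (k + 1), divPow (r : ℂ) (i + 1) • e i :=
    fun r => rfl
  have h1 : headOp k M m * headOp k M n - headOp k M n * headOp k M m =
      ∑ q ∈ Finset.range (k + 1) ×ˢ Finset.range (k + 1),
        (divPow (m : ℂ) (q.1 + 1) * divPow (n : ℂ) (q.2 + 1) * ((q.2 : ℂ) - q.1)) •
          e (q.1 + q.2) := by
    rw [hh, hh, Finset.sum_mul_sum, Finset.sum_mul_sum, Finset.sum_product,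
      Finset.sum_comm (f := fun i j => (divPow (n : ℂ) (i + 1) • e i) *
        (divPow (m : ℂ) (j + 1) • e j)), ← Finset.sum_sub_distrib]
    refine Finset.sum_congr rfl fun i _ => ?_
    rw [← Finset.sum_sub_distrib]
    refine Finset.sum_congr rfl fun j _ => ?_
    rw [mul_smul, ← hcomm, smul_mul_smul_comm, smul_mul_smul_comm,
      mul_comm (divPow (n : ℂ) (j + 1)), smul_sub]
  have h2 : ∑ q ∈ Finset.range (k + 1) ×ˢ Finset.range (k + 1),
        (divPow (m : ℂ) (q.1 + 1) * divPow (n : ℂ) (q.2 + 1) * ((q.2 : ℂ) - q.1)) •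
          e (q.1 + q.2) = ∑ p ∈ Finset.range (k + 1), ∑ q ∈ Finset.HasAntidiagonal.antidiagonal p,
        (divPow (m : ℂ) (q.1 + 1) * divPow (n : ℂ) (q.2 + 1) * ((q.2 : ℂ) - q.1)) • e p := by
    rw [← Finset.sum_filter_add_sum_filter_not _
      (fun q : ℕ × ℕ => q.1 + q.2 ∈ Finset.range (k + 1))]
    rw [Finset.sum_eq_zero (s := Finset.filter
      (fun q : ℕ × ℕ => ¬ q.1 + q.2 ∈ Finset.range (k + 1)) _), add_zero,
      ← Finset.sum_fiberwise_of_maps_to (t := Finset.range (k + 1))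
        (g := fun q : ℕ × ℕ => q.1 + q.2)]
    · refine Finset.sum_congr rfl fun p hp => ?_
      rw [Finset.mem_range] at hp
      refine Finset.sum_congr ?_ ?_
      · ext q
        simp only [Finset.mem_filter, Finset.mem_product, Finset.mem_range,
          Finset.HasAntidiagonal.mem_antidiagonal]
        omega
      · intro q hq
        rw [Finset.HasAntidiagonal.mem_antidiagonal] at hq
        rw [hq]
    · intro q hq
      exact (Finset.mem_filter.mp hq).2
    · intro q hq
      have hq2 := (Finset.mem_filter.mp hq).2
      rw [Finset.mem_range] at hq2
      rw [he0 _ (by omega), smul_zero]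
  rw [h1, h2, hh, hh, hh, Finset.smul_sum, Finset.smul_sum, Finset.smul_sum,
    ← Finset.sum_add_distrib, ← Finset.sum_sub_distrib]
  refine Finset.sum_congr rfl fun p _ => ?_
  rw [← Finset.sum_smul, sum_coeff]
  push_cast
  module

/-- The operator
`v ⊗ t ^ n ↦ (n + ∑_{i = 0}^k m ^ (i + 1) / (i + 1)! d_i) v ⊗ t ^ (n + m) + v ⊗ β t ^ (n + m)`
on `M ⊗ ℂ[t, t⁻¹]`. -/
noncomputable def op (β : ℂ[T;T⁻¹]) (m : ℤ) : Module.End ℂ (M ⊗[ℂ] ℂ[T;T⁻¹]) :=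
  TensorProduct.map LinearMap.id (laurentMul (LaurentPolynomial.T m) * laurentD) +
    TensorProduct.map (headOp k M m) (laurentMul (LaurentPolynomial.T m)) +
    TensorProduct.map LinearMap.id (laurentMul (β * LaurentPolynomial.T m))

/-- The defining formula of the action. -/
theorem op_tmul_T (β : ℂ[T;T⁻¹]) (m n : ℤ) (w : M) :
    op k M β m (w ⊗ₜ LaurentPolynomial.T n) =
      ((n : ℂ) • w + ∑ i ∈ Finset.range (k + 1),
        ((m : ℂ) ^ (i + 1) / ((i + 1).factorial : ℂ)) • ⁅TruncVir.d k i, w⁆) ⊗ₜ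
          LaurentPolynomial.T (n + m) + w ⊗ₜ (β * LaurentPolynomial.T (m + n)) := by
  rw [op, LinearMap.add_apply, LinearMap.add_apply, TensorProduct.map_tmul,
    TensorProduct.map_tmul, TensorProduct.map_tmul, Module.End.mul_apply, laurentD_T, map_smul,
    laurentMul_apply, laurentMul_apply, mul_assoc, ← LaurentPolynomial.T_add, add_comm n m,
    TensorProduct.add_tmul, TensorProduct.tmul_smul, TensorProduct.smul_tmul', headOp]
  simp

theorem op_comm (β : ℂ[T;T⁻¹]) (m n : ℤ) :
    op k M β m * op k M β n - op k M β n * op k M β m = ((n : ℂ) - m) • op k M β (m + n) := by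
  set τ : ℤ → Module.End ℂ ℂ[T;T⁻¹] := fun r => laurentMul (LaurentPolynomial.T r) with hτ
  set D' : Module.End ℂ ℂ[T;T⁻¹] := laurentD + laurentMul β with hD'
  have hop : ∀ r, op k M β r = TensorProduct.map LinearMap.id (τ r * D') +
      TensorProduct.map (headOp k M r) (τ r) := by
    intro r
    rw [op, hD', mul_add, TensorProduct.map_add_right, hτ]
    simp only [laurentMul_mul, mul_comm β]
    abel
  have hττ : ∀ r s, τ r * τ s = τ (r + s) := by
    intro r s
    rw [hτ]
    simp only [laurentMul_mul, LaurentPolynomial.T_add]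
  have hDτ : ∀ r, D' * τ r = τ r * D' + (r : ℂ) • τ r := by
    intro r
    rw [hD', hτ]
    simp only [add_mul, mul_add, laurentD_mul, laurentMul_mul, mul_comm β]
    abel
  clear_value τ D'
  have key : ∀ r s, op k M β r * op k M β s =
      TensorProduct.map LinearMap.id (τ (r + s) * D' * D') +
      (s : ℂ) • TensorProduct.map LinearMap.id (τ (r + s) * D') +
      TensorProduct.map (headOp k M s) (τ (r + s) * D') +
      (s : ℂ) • TensorProduct.map (headOp k M s) (τ (r + s)) +
      TensorProduct.map (headOp k M r) (τ (r + s) * D') +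
      TensorProduct.map (headOp k M r * headOp k M s) (τ (r + s)) := by
    intro r s
    have e1 : τ r * D' * τ s = τ (r + s) * D' + (s : ℂ) • τ (r + s) := by
      rw [mul_assoc, hDτ, mul_add, ← mul_assoc, hττ, mul_smul_comm, hττ]
    have hid : ∀ f : Module.End ℂ M, LinearMap.id * f = f := fun f => one_mul f
    have hid' : ∀ f : Module.End ℂ M, f * LinearMap.id = f := fun f => mul_one f
    rw [hop r, hop s, add_mul, mul_add, mul_add, ← TensorProduct.map_mul, ← TensorProduct.map_mul,
      ← TensorProduct.map_mul, ← TensorProduct.map_mul, ← mul_assoc, ← mul_assoc, e1, hττ,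
      hid, hid, hid', add_mul, smul_mul_assoc, TensorProduct.map_add_right,
      TensorProduct.map_add_right, TensorProduct.map_smul_right, TensorProduct.map_smul_right]
    abel
  rw [key, key, add_comm n m, hop]
  have hc := congrArg (fun f => TensorProduct.map f (τ (m + n))) (headOp_comm k M m n)
  simp only [sub_eq_add_neg, TensorProduct.map_add_left, TensorProduct.map_smul_left,
    ← neg_one_smul ℂ (headOp k M n * headOp k M m), ← neg_one_smul ℂ ((n : ℂ) • headOp k M n)]
    at hc
  rw [← eq_sub_iff_add_eq] at hc
  rw [hc]
  module

end LoopMod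

/-- The space `M ⊗ ℂ[t, t⁻¹]` underlying the module `N(M, β)`. -/
def LoopMod (_k : ℕ) (M : Type*) [AddCommGroup M] [Module ℂ M] (_β : ℂ[T;T⁻¹]) : Type _ :=
  M ⊗[ℂ] ℂ[T;T⁻¹]

namespace LoopMod

variable (k : ℕ) (M : Type*) [AddCommGroup M] [Module ℂ M] [LieRingModule (TruncVir k) M]
  [LieModule ℂ (TruncVir k) M] (β : ℂ[T;T⁻¹])

noncomputable instance : AddCommGroup (LoopMod k M β) :=
  inferInstanceAs (AddCommGroup (M ⊗[ℂ] ℂ[T;T⁻¹]))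

noncomputable instance : Module ℂ (LoopMod k M β) :=
  inferInstanceAs (Module ℂ (M ⊗[ℂ] ℂ[T;T⁻¹]))

/-- The representation `d m ↦ op m`, `c ↦ 0`. -/
noncomputable def rep : Vir →ₗ[ℂ] Module.End ℂ (LoopMod k M β) := chargelessRep (op k M β)

noncomputable instance : LieRingModule Vir (LoopMod k M β) :=
  lieRingModuleOfRep (rep k M β) (chargelessRep_lie _ (op_comm k M β))

instance : LieModule ℂ Vir (LoopMod k M β) :=
  lieModuleOfRep (rep k M β) (chargelessRep_lie _ (op_comm k M β))

end LoopMod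

/-! ## Highest weight modules and induced modules -/

/-- The universal enveloping algebra of the Virasoro algebra. -/
abbrev UVir : Type := UniversalEnvelopingAlgebra ℂ Vir

section EnvelopingModules

attribute [local instance] LieRing.ofAssociativeRing

variable (X : Type*) [AddCommGroup X] [Module ℂ X] [Module UVir X] [IsScalarTower ℂ UVir X]

/-- The representation of the Virasoro algebra on a module over its enveloping algebra. -/
noncomputable def envRep : Vir →ₗ[ℂ] Module.End ℂ X :=
  (Algebra.lsmul ℂ ℂ X).toLinearMap ∘ₗ (UniversalEnvelopingAlgebra.ι ℂ (L := Vir)).toLinearMap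

theorem envRep_lie (x y : Vir) :
    envRep X ⁅x, y⁆ = envRep X x * envRep X y - envRep X y * envRep X x := by
  change Algebra.lsmul ℂ ℂ X (UniversalEnvelopingAlgebra.ι ℂ ⁅x, y⁆) = _
  rw [LieHom.map_lie, LieRing.of_associative_ring_bracket, map_sub, map_mul, map_mul]
  rfl

end EnvelopingModules

/-- The left ideal `I(θ, h)` generated by `d i`, `i > 0`, `d 0 - h` and `c - θ`. -/
noncomputable def vermaIdeal (θ h : ℂ) : Submodule UVir UVir :=
  Submodule.span UVir
    ({u | ∃ i : ℤ, 0 < i ∧ u = UniversalEnvelopingAlgebra.ι ℂ (Vir.d i)} ∪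
      {UniversalEnvelopingAlgebra.ι ℂ (Vir.d 0) - algebraMap ℂ UVir h,
        UniversalEnvelopingAlgebra.ι ℂ Vir.c - algebraMap ℂ UVir θ})

/-- The Verma module with highest weight `(θ, h)`. -/
abbrev Verma (θ h : ℂ) : Type := UVir ⧸ vermaIdeal θ h

/-- The unique maximal proper submodule of the Verma module: the sum of all its proper
submodules. -/
noncomputable def vermaRadical (θ h : ℂ) : Submodule UVir (Verma θ h) :=
  sSup {J | J ≠ ⊤}

/-- The irreducible highest weight module `V(θ, h)`. -/
def HighestWeight (θ h : ℂ) : Type := Verma θ h ⧸ vermaRadical θ h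

namespace HighestWeight

variable (θ h : ℂ)

noncomputable instance : AddCommGroup (HighestWeight θ h) :=
  inferInstanceAs (AddCommGroup (Verma θ h ⧸ vermaRadical θ h))

noncomputable instance : Module ℂ (HighestWeight θ h) :=
  inferInstanceAs (Module ℂ (Verma θ h ⧸ vermaRadical θ h))

noncomputable instance : Module UVir (HighestWeight θ h) :=
  inferInstanceAs (Module UVir (Verma θ h ⧸ vermaRadical θ h))

instance : IsScalarTower ℂ UVir (HighestWeight θ h) :=
  inferInstanceAs (IsScalarTower ℂ UVir (Verma θ h ⧸ vermaRadical θ h))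

noncomputable instance : LieRingModule Vir (HighestWeight θ h) :=
  lieRingModuleOfRep (envRep (HighestWeight θ h)) (envRep_lie (HighestWeight θ h))

instance : LieModule ℂ Vir (HighestWeight θ h) :=
  lieModuleOfRep (envRep (HighestWeight θ h)) (envRep_lie (HighestWeight θ h))

end HighestWeight

section Induced

variable (N : Type*) [AddCommGroup N] [Module ℂ N] [LieRingModule VirPlus N]
  [LieModule ℂ VirPlus N]

/-- The relations `u x ⊗ n = u ⊗ x n` for `x` in `VirPlus`. -/
noncomputable def indRelations : Submodule UVir (UVir ⊗[ℂ] N) :=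
  Submodule.span UVir {y | ∃ (x : VirPlus) (n : N),
    y = UniversalEnvelopingAlgebra.ι ℂ (x : Vir) ⊗ₜ[ℂ] n - (1 : UVir) ⊗ₜ[ℂ] ⁅x, n⁆}

/-- The induced module `Ind(N)`, the tensor product of `U(Vir)` and `N` over `U(VirPlus)`. -/
abbrev Ind : Type _ := (UVir ⊗[ℂ] N) ⧸ indRelations N

/-- The submodule `(c - θ) Ind(N)`. -/
noncomputable def centralSubmodule (θ : ℂ) : Submodule UVir (Ind N) :=
  Submodule.span UVir {y | ∃ z : Ind N,
    y = (UniversalEnvelopingAlgebra.ι ℂ Vir.c - algebraMap ℂ UVir θ) • z}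

/-- The module `Ind_θ(N) = Ind(N) / (c - θ) Ind(N)`. -/
def IndTheta (θ : ℂ) : Type _ := Ind N ⧸ centralSubmodule N θ

namespace IndTheta

variable (θ : ℂ)

noncomputable instance : AddCommGroup (IndTheta N θ) :=
  inferInstanceAs (AddCommGroup (Ind N ⧸ centralSubmodule N θ))

noncomputable instance : Module ℂ (IndTheta N θ) :=
  inferInstanceAs (Module ℂ (Ind N ⧸ centralSubmodule N θ))

noncomputable instance : Module UVir (IndTheta N θ) :=
  inferInstanceAs (Module UVir (Ind N ⧸ centralSubmodule N θ))

instance : IsScalarTower ℂ UVir (IndTheta N θ) :=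
  inferInstanceAs (IsScalarTower ℂ UVir (Ind N ⧸ centralSubmodule N θ))

noncomputable instance : LieRingModule Vir (IndTheta N θ) :=
  lieRingModuleOfRep (envRep (IndTheta N θ)) (envRep_lie (IndTheta N θ))

instance : LieModule ℂ Vir (IndTheta N θ) :=
  lieModuleOfRep (envRep (IndTheta N θ)) (envRep_lie (IndTheta N θ))

end IndTheta

end Induced

/-! ## The classes of modules to compare with -/

section Classes

variable (X : Type u) [AddCommGroup X] [Module ℂ X] [LieRingModule Vir X] [LieModule ℂ Vir X]

/-- The element `d n` acts locally finitely on `X`. -/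
def ActsLocallyFinitely (n : ℤ) : Prop :=
  ∀ x : X, ∃ S : Submodule ℂ X, FiniteDimensional ℂ S ∧ x ∈ S ∧ ∀ y ∈ S, ⁅Vir.d n, y⁆ ∈ S

/-- `d n` acts locally finitely on `X` for all sufficiently large `n`. -/
def EventuallyLocallyFinite : Prop := ∃ K : ℕ, ∀ n : ℕ, K < n → ActsLocallyFinitely X n

/-- `X` is isomorphic to one of the irreducible modules locally finite over a positive part:
an induced module `Ind_θ(N)`, where `N` is an irreducible `VirPlus`-module on which, for some
`k > 0`, `d k` is injective and all `d i` with `i > k` are zero; an irreducible highest weight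
module `V(θ, h)`; or any irreducible module on which `d n` is locally finite for large `n`. -/
def IsLocallyFiniteType : Prop :=
  (∃ (N : Type v) (_ : AddCommGroup N) (_ : Module ℂ N) (_ : LieRingModule VirPlus N)
      (_ : LieModule ℂ VirPlus N) (k : ℕ) (θ : ℂ),
    LieModule.IsIrreducible ℂ VirPlus N ∧ 0 < k ∧
    (∀ n : N, ⁅VirPlus.d k, n⁆ = 0 → n = 0) ∧ (∀ i > k, ∀ n : N, ⁅VirPlus.d i, n⁆ = 0) ∧
    Nonempty (X ≃ₗ⁅ℂ,Vir⁆ IndTheta N θ)) ∨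
  (∃ θ h : ℂ, Nonempty (X ≃ₗ⁅ℂ,Vir⁆ HighestWeight θ h)) ∨
  (∃ (Y : Type v) (_ : AddCommGroup Y) (_ : Module ℂ Y) (_ : LieRingModule Vir Y)
      (_ : LieModule ℂ Vir Y),
    LieModule.IsIrreducible ℂ Vir Y ∧ EventuallyLocallyFinite Y ∧ Nonempty (X ≃ₗ⁅ℂ,Vir⁆ Y))

/-- `X` is isomorphic to `A_b` for some irreducible module `A` over the algebra of differential
operators `ℂ[t, t⁻¹, t d/dt]` and some `b`. -/
def IsTwistedWeylType : Prop :=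
  ∃ (A : Type v) (_ : AddCommGroup A) (_ : Module ℂ A) (_ : Module DiffOp A)
    (_ : IsScalarTower ℂ DiffOp A) (b : ℂ),
    IsSimpleModule DiffOp A ∧ Nonempty (X ≃ₗ⁅ℂ,Vir⁆ TwistedWeyl A b)

/-- `X` is isomorphic to `N(M, β)` for some Laurent polynomial `β` and some irreducible
`𝔞_k`-module `M`, `k > 0`, on which `d k` acts injectively. -/
def IsLoopType : Prop :=
  ∃ (k : ℕ) (M : Type v) (_ : AddCommGroup M) (_ : Module ℂ M) (_ : LieRingModule (TruncVir k) M)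
    (_ : LieModule ℂ (TruncVir k) M) (β : ℂ[T;T⁻¹]),
    0 < k ∧ LieModule.IsIrreducible ℂ (TruncVir k) M ∧
    (∀ w : M, ⁅TruncVir.d k k, w⁆ = 0 → w = 0) ∧ Nonempty (X ≃ₗ⁅ℂ,Vir⁆ LoopMod k M β)

/-- `X` is isomorphic to `Ω(μ_1, b_1) ⊗ ⋯ ⊗ Ω(μ_k, b_k) ⊗ W` with `k > 0`, distinct `μ_i`,
nonzero `b_i`, and a module `W` on which `d n` is locally finite for large `n`. -/
def IsTensorType : Prop :=
  ∃ (k : ℕ) (mu : Fin k → ℂˣ) (b : Fin k → ℂ) (W : Type v) (_ : AddCommGroup W) (_ : Module ℂ W)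
    (_ : LieRingModule Vir W) (_ : LieModule ℂ Vir W),
    0 < k ∧ Function.Injective mu ∧ (∀ i, b i ≠ 0) ∧ EventuallyLocallyFinite W ∧
    Nonempty (X ≃ₗ⁅ℂ,Vir⁆ ((⨂[ℂ] i, OmegaOne (mu i) (b i)) ⊗[ℂ] W))

end Classes

/-! The modules are told apart by how `d n`, and `d (l - m) d m` for a fixed sum of indices `l`,
depend on large indices.

An irreducible `V` that is locally finite over a positive part is smooth: every vector is killed by
all `d n` with `n` large. Hence for each `v` in `V` the map `p ↦ p ⊗ v` commutes with `d n` for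
large `n`. Both forms of `X` thus receive an injective linear map `e` from `ℂ[t, s]` that commutes
with `d n` for large `n` (`IsEventualHom`), and this is nearly all that the argument uses.

On a polynomial `f(t)` one has `d m f = λ ^ m (s f + m ^ 2 Q f + m L f)`, where `Q = α (d/dt - q)`
and `q = (h(t) - h(α)) / (t - α)`. So `d (l - m) d m f` is `λ ^ l` times a polynomial in `m` of
degree at most `4`, with coefficient `Q (Q f)` in degree `4`. Irreducibility forces `α ≠ 0`, and
then `Q ^ 2 ≠ 0`. A polynomial sequence is determined by its values at enough consecutive integers
(`PolyTop.eq_zero`), so these coefficients can be compared across an isomorphism.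

Class 1 consists of smooth modules, whereas `d n (e 1)` never vanishes for large `n`, because of the
term `λ ^ n s`. In class 2 the expression `d (l - m) d m` is quadratic in `m`, so it has no term in
`m ^ 4`. In class 3 it has degree `2 k + 2`, and its top coefficient is an injective operator on `M`
tensored with `t ^ l`; on `X` the same coefficient depends on `l` only through the scalar `λ ^ l`,
so `t ^ (l + 1) - λ t ^ l` would kill a nonzero vector. In class 4 the factor `Ω(μ_i, b_i)` makes
the function `μ_i ^ m` visible, while on `X` only `λ ^ m` times polynomials in `m` occur. Hence
every `μ_i` equals `λ`, distinctness leaves a single factor, and then `d (l - m) d m` is again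
quadratic for large indices. -/

set_option linter.unusedSectionVars false

/-! ## Polynomial sequences with values in a vector space -/

section PolySequences

variable {E F G : Type*} [AddCommGroup E] [Module ℂ E] [AddCommGroup F] [Module ℂ F]
  [AddCommGroup G] [Module ℂ G]

/-- The sequences `ℤ → E` that are polynomial of degree less than `d`. -/
noncomputable def PolyLT (E : Type*) [AddCommGroup E] [Module ℂ E] (d : ℕ) :
    Submodule ℂ (ℤ → E) :=
  Submodule.span ℂ {u | ∃ j < d, ∃ c : E, u = fun m : ℤ => (m : ℂ) ^ j • c}

/-- The sequence `u` is polynomial of degree at most `d`, with coefficient `c` in degree `d`. -/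
def PolyTop (d : ℕ) (c : E) (u : ℤ → E) : Prop :=
  (u - fun m : ℤ => (m : ℂ) ^ d • c) ∈ PolyLT E d

theorem polyLT_monomial {j d : ℕ} (hj : j < d) (c : E) :
    (fun m : ℤ => (m : ℂ) ^ j • c) ∈ PolyLT E d :=
  Submodule.subset_span ⟨j, hj, c, rfl⟩

theorem polyLT_mono {d e : ℕ} (h : d ≤ e) : PolyLT E d ≤ PolyLT E e := by
  refine Submodule.span_le.mpr ?_
  rintro u ⟨j, hj, c, rfl⟩
  exact polyLT_monomial (hj.trans_le h) c

theorem PolyTop.mem_polyLT {d e : ℕ} {c : E} {u : ℤ → E} (h : PolyTop d c u) (hd : d < e) :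
    u ∈ PolyLT E e := by
  rw [← sub_add_cancel u fun m : ℤ => (m : ℂ) ^ d • c]
  exact Submodule.add_mem _ (polyLT_mono hd.le h) (polyLT_monomial hd c)

theorem polyTop_zero_iff {d : ℕ} {u : ℤ → E} : PolyTop d 0 u ↔ u ∈ PolyLT E d := by
  have e : (u - fun m : ℤ => (m : ℂ) ^ d • (0 : E)) = u := by
    ext m; simp
  rw [PolyTop, e]

theorem polyTop_monomial (d : ℕ) (c : E) : PolyTop d c fun m : ℤ => (m : ℂ) ^ d • c := by
  rw [PolyTop, sub_self]
  exact Submodule.zero_mem _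

theorem polyTop_const (c : E) : PolyTop 0 c fun _ : ℤ => c := by
  simpa using polyTop_monomial 0 c

theorem PolyTop.add {d : ℕ} {c c' : E} {u u' : ℤ → E} (h : PolyTop d c u) (h' : PolyTop d c' u') :
    PolyTop d (c + c') (fun m => u m + u' m) := by
  have := Submodule.add_mem _ h h'
  rw [PolyTop]
  convert this using 1
  ext m
  simp only [Pi.sub_apply, Pi.add_apply, smul_add]
  abel

theorem PolyTop.add_polyLT {d : ℕ} {c : E} {u u' : ℤ → E} (h : PolyTop d c u)
    (h' : u' ∈ PolyLT E d) : PolyTop d c (fun m => u m + u' m) := by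
  simpa using h.add (polyTop_zero_iff.mpr h')

theorem PolyTop.sub {d : ℕ} {c c' : E} {u u' : ℤ → E} (h : PolyTop d c u) (h' : PolyTop d c' u') :
    PolyTop d (c - c') (fun m => u m - u' m) := by
  have := Submodule.sub_mem _ h h'
  rw [PolyTop]
  convert this using 1
  ext m
  simp only [Pi.sub_apply, smul_sub]
  abel

theorem polyLT_map (f : E →ₗ[ℂ] F) {d : ℕ} {u : ℤ → E} (h : u ∈ PolyLT E d) :
    (fun m => f (u m)) ∈ PolyLT F d := by
  have h' : f.compLeft ℤ u ∈ (PolyLT E d).map (f.compLeft ℤ) := ⟨u, h, rfl⟩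
  rw [PolyLT, Submodule.map_span] at h'
  refine Submodule.span_mono ?_ h'
  rintro _ ⟨_, ⟨j, hj, c, rfl⟩, rfl⟩
  exact ⟨j, hj, f c, by ext m; simp⟩

theorem PolyTop.map (f : E →ₗ[ℂ] F) {d : ℕ} {c : E} {u : ℤ → E} (h : PolyTop d c u) :
    PolyTop d (f c) (fun m => f (u m)) := by
  have := polyLT_map f h
  rw [PolyTop]
  convert this using 1
  ext m
  simp

/-- Degrees below `d` and below `e` multiply to a degree at most `d + e - 2`, which is below `g`
exactly under the stated bound. -/
theorem polyLT_bilin (B : E →ₗ[ℂ] F →ₗ[ℂ] G) {d e g : ℕ} (hg : d + e ≤ g + 1) {u : ℤ → E}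
    {v : ℤ → F} (hu : u ∈ PolyLT E d) (hv : v ∈ PolyLT F e) :
    (fun m => B (u m) (v m)) ∈ PolyLT G g := by
  induction hu using Submodule.span_induction with
  | zero =>
    convert Submodule.zero_mem (PolyLT G g) using 1
    ext m; simp
  | add u u' _ _ h h' =>
    convert Submodule.add_mem _ h h' using 1
    ext m; simp
  | smul a u _ h =>
    convert Submodule.smul_mem _ a h using 1
    ext m; simp
  | mem u hu =>
    obtain ⟨i, hi, c, rfl⟩ := hu
    induction hv using Submodule.span_induction with
    | zero =>
      convert Submodule.zero_mem (PolyLT G g) using 1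
      ext m; simp
    | add u u' _ _ h h' =>
      convert Submodule.add_mem _ h h' using 1
      ext m; simp
    | smul a u _ h =>
      convert Submodule.smul_mem _ a h using 1
      ext m; simp [smul_comm a]
    | mem v hv =>
      obtain ⟨j, hj, c', rfl⟩ := hv
      refine Submodule.subset_span ⟨i + j, by omega, B c c', ?_⟩
      ext m
      simp [smul_smul, pow_add, mul_comm]

/-- The error splits as `B (u - m ^ d c, v) + B (m ^ d c, v - m ^ e c')`, and both terms have degree
below `d + e`. -/
theorem PolyTop.bilin (B : E →ₗ[ℂ] F →ₗ[ℂ] G) {d e : ℕ} {c : E} {c' : F} {u : ℤ → E} {v : ℤ → F}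
    (hu : PolyTop d c u) (hv : PolyTop e c' v) :
    PolyTop (d + e) (B c c') (fun m => B (u m) (v m)) := by
  have h1 := polyLT_bilin B (g := d + e) (by omega) hu (hv.mem_polyLT (Nat.lt_succ_self e))
  have h2 := polyLT_bilin B (g := d + e) (by omega) (polyLT_monomial (Nat.lt_succ_self d) c) hv
  rw [PolyTop]
  convert Submodule.add_mem _ h1 h2 using 1
  ext m
  simp only [Pi.sub_apply, Pi.add_apply, map_sub, map_smul, LinearMap.sub_apply,
    LinearMap.smul_apply, smul_smul, pow_add, mul_comm ((m : ℂ) ^ d)]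
  abel

theorem PolyTop.smul {d e : ℕ} {a : ℂ} {c : E} {u : ℤ → ℂ} {v : ℤ → E} (hu : PolyTop d a u)
    (hv : PolyTop e c v) : PolyTop (d + e) (a • c) (fun m => u m • v m) :=
  hu.bilin (LinearMap.lsmul ℂ E) hv

theorem PolyTop.const_smul {d : ℕ} (a : ℂ) {c : E} {v : ℤ → E}
    (hv : PolyTop d c v) : PolyTop d (a • c) (fun m => a • v m) :=
  hv.map (LinearMap.lsmul ℂ E a)

theorem PolyTop.mul {A : Type*} [Ring A] [Algebra ℂ A] {d e : ℕ} {a b : A} {u v : ℤ → A}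
    (hu : PolyTop d a u) (hv : PolyTop e b v) : PolyTop (d + e) (a * b) (fun m => u m * v m) :=
  hu.bilin (LinearMap.mul ℂ A) hv

theorem PolyTop.apply {d e : ℕ} {f : E →ₗ[ℂ] F} {c : E} {u : ℤ → E →ₗ[ℂ] F} {v : ℤ → E}
    (hu : PolyTop d f u) (hv : PolyTop e c v) : PolyTop (d + e) (f c) (fun m => u m (v m)) :=
  hu.bilin LinearMap.id hv

theorem PolyTop.apply_const {d : ℕ} {f : E →ₗ[ℂ] F} {u : ℤ → E →ₗ[ℂ] F} (hu : PolyTop d f u)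
    (x : E) : PolyTop d (f x) (fun m => u m x) :=
  hu.map (LinearMap.applyₗ x)

theorem polyTop_intCast : PolyTop 1 (1 : ℂ) fun m : ℤ => (m : ℂ) := by
  simpa using polyTop_monomial 1 (1 : ℂ)

theorem polyTop_sub_intCast (l : ℤ) : PolyTop 1 (-1 : ℂ) fun m : ℤ => ((l - m : ℤ) : ℂ) := by
  have h := (polyTop_intCast.const_smul (-1)).add_polyLT
    (polyLT_monomial (d := 1) zero_lt_one (l : ℂ))
  convert h using 1
  · simp
  · ext m; simp; ring

theorem PolyTop.pow {A : Type*} [Ring A] [Algebra ℂ A] {d : ℕ} {a : A} {u : ℤ → A}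
    (h : PolyTop d a u) (n : ℕ) : PolyTop (n * d) (a ^ n) (fun m => u m ^ n) := by
  induction n with
  | zero => simpa using polyTop_const (1 : A)
  | succ n ih =>
    have := ih.mul h
    simpa only [pow_succ, Nat.succ_mul] using this

theorem polyLT_reflect (l : ℤ) {d : ℕ} {u : ℤ → E} (h : u ∈ PolyLT E d) :
    (fun m => u (l - m)) ∈ PolyLT E d := by
  induction h using Submodule.span_induction with
  | zero => exact Submodule.zero_mem (PolyLT E d)
  | add u u' _ _ h h' => exact Submodule.add_mem _ h h'
  | smul a u _ h => exact Submodule.smul_mem _ a h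
  | mem u hu =>
    obtain ⟨j, hj, c, rfl⟩ := hu
    have h := ((polyTop_sub_intCast l).pow j).smul (polyTop_const c)
    exact h.mem_polyLT (by omega)

theorem PolyTop.reflect (l : ℤ) {d : ℕ} {c : E} {u : ℤ → E} (h : PolyTop d c u) :
    PolyTop d ((-1 : ℂ) ^ d • c) (fun m => u (l - m)) := by
  have h1 := polyLT_reflect l h
  have h2 := ((polyTop_sub_intCast l).pow d).smul (polyTop_const c)
  rw [mul_one, add_zero] at h2
  have h3 := h2.add_polyLT h1
  convert h3 using 1
  ext m
  simp

theorem PolyTop.reflect_of_even (l : ℤ) {d : ℕ} (hd : Even d) {c : E} {u : ℤ → E}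
    (h : PolyTop d c u) : PolyTop d c (fun m => u (l - m)) := by
  have := h.reflect l
  rwa [hd.neg_one_pow, one_smul] at this

theorem exists_polynomial_of_mem_polyLT {d : ℕ} {u : ℤ → ℂ} (h : u ∈ PolyLT ℂ d) :
    ∃ p : ℂ[X], p.degree < d ∧ ∀ m : ℤ, u m = p.eval (m : ℂ) := by
  induction h using Submodule.span_induction with
  | zero => exact ⟨0, by simp, by simp⟩
  | add u u' _ _ h h' =>
    obtain ⟨p, hp, hp'⟩ := h
    obtain ⟨q, hq, hq'⟩ := h'
    exact ⟨p + q, (Polynomial.degree_add_le _ _).trans_lt (max_lt hp hq), by simp [hp', hq']⟩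
  | smul a u _ h =>
    obtain ⟨p, hp, hp'⟩ := h
    exact ⟨a • p, (Polynomial.degree_smul_le _ _).trans_lt hp, by simp [hp']⟩
  | mem u hu =>
    obtain ⟨j, hj, c, rfl⟩ := hu
    refine ⟨Polynomial.C c * Polynomial.X ^ j,
      (Polynomial.degree_C_mul_X_pow_le _ _).trans_lt (by exact_mod_cast hj), ?_⟩
    intro m
    change (m : ℂ) ^ j * c = _
    rw [Polynomial.eval_mul, Polynomial.eval_C, Polynomial.eval_pow,
      Polynomial.eval_X, mul_comm]

/-- A polynomial sequence of degree at most `d` that vanishes at `d + 1` consecutive integers has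
vanishing coefficient in degree `d`. -/
theorem PolyTop.eq_zero {d : ℕ} {c : E} {u : ℤ → E} (h : PolyTop d c u) (K : ℤ)
    (h0 : ∀ m, K ≤ m → m ≤ K + d → u m = 0) : c = 0 := by
  -- Testing against linear functionals reduces to scalar sequences, where a polynomial of degree at
  -- most `d` with `d + 1` roots is zero.
  refine (Module.forall_dual_apply_eq_zero_iff ℂ c).mp fun ξ => ?_
  obtain ⟨p, hp, hpe⟩ := exists_polynomial_of_mem_polyLT (h.map ξ)
  have hq : p + Polynomial.C (ξ c) * Polynomial.X ^ d = 0 := by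
    refine Polynomial.eq_zero_of_degree_lt_of_eval_finset_eq_zero
      ((Finset.Icc K (K + d)).map ⟨fun m : ℤ => (m : ℂ), Int.cast_injective⟩) ?_ ?_
    · rw [Finset.card_map, Int.card_Icc, show (K + d + 1 - K).toNat = d + 1 by omega]
      refine (Polynomial.degree_add_le _ _).trans_lt (max_lt (hp.trans ?_) ?_)
      · exact_mod_cast Nat.lt_succ_self d
      · exact (Polynomial.degree_C_mul_X_pow_le _ _).trans_lt
          (by exact_mod_cast Nat.lt_succ_self d)
    · intro x hx
      obtain ⟨m, hm, rfl⟩ := Finset.mem_map.mp hx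
      rw [Finset.mem_Icc] at hm
      have := hpe m
      rw [Pi.sub_apply, h0 m hm.1 hm.2] at this
      rw [Function.Embedding.coeFn_mk, Polynomial.eval_add, ← this, Polynomial.eval_mul,
        Polynomial.eval_C, Polynomial.eval_pow, Polynomial.eval_X, map_zero, smul_eq_mul]
      ring
  have := congrArg (fun q => Polynomial.coeff q d) hq
  simpa [Polynomial.coeff_eq_zero_of_degree_lt hp] using this

end PolySequences

/-! ## Smooth vectors -/

section Smooth

variable (X : Type*) [AddCommGroup X] [Module ℂ X] [LieRingModule Vir X] [LieModule ℂ Vir X]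

/-- The submodule of vectors killed by `d n` for all sufficiently large `n`. -/
noncomputable def smoothVectors : LieSubmodule ℂ Vir X where
  carrier := {x | ∃ K : ℤ, ∀ n ≥ K, ⁅Vir.d n, x⁆ = 0}
  zero_mem' := ⟨0, fun n _ => lie_zero _⟩
  add_mem' := by
    rintro x y ⟨K, hK⟩ ⟨K', hK'⟩
    refine ⟨max K K', fun n hn => ?_⟩
    rw [lie_add, hK n (le_of_max_le_left hn), hK' n (le_of_max_le_right hn), add_zero]
  smul_mem' := by
    rintro a x ⟨K, hK⟩
    exact ⟨K, fun n hn => by rw [lie_smul, hK n hn, smul_zero]⟩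
  lie_mem := by
    rintro y x ⟨K, hK⟩
    induction y using Vir.induction with
    | hc =>
      refine ⟨K, fun n hn => ?_⟩
      rw [leibniz_lie, hK n hn, lie_zero, add_zero, ← lie_skew, Vir.lie_c_left, neg_zero, zero_lie]
    | hadd y y' h h' =>
      obtain ⟨L, hL⟩ := h
      obtain ⟨L', hL'⟩ := h'
      refine ⟨max L L', fun n hn => ?_⟩
      rw [add_lie, lie_add, hL n (le_of_max_le_left hn), hL' n (le_of_max_le_right hn), add_zero]
    | hsmul a y h =>
      obtain ⟨L, hL⟩ := h
      exact ⟨L, fun n hn => by rw [smul_lie, lie_smul, hL n hn, smul_zero]⟩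
    | hd i =>
      -- The bound `K - i` makes `d (n + i)` kill `x`; the bound `1 - i` excludes `n = -i`, so the
      -- bracket has no central term.
      refine ⟨max K (max (K - i) (1 - i)), fun n hn => ?_⟩
      have h1 : K ≤ n := le_of_max_le_left hn
      have h2 : K ≤ n + i := by have := le_of_max_le_left (le_of_max_le_right hn); omega
      have h3 : n ≠ -i := by have := le_of_max_le_right (le_of_max_le_right hn); omega
      rw [leibniz_lie, hK n h1, lie_zero, add_zero, Vir.lie_d_d, if_neg h3, zero_smul, add_zero,
        smul_lie, hK _ h2, smul_zero]

variable {X}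

theorem LieModuleEquiv.apply_lie {Y : Type*} [AddCommGroup Y] [Module ℂ Y] [LieRingModule Vir Y]
    (φ : X ≃ₗ⁅ℂ,Vir⁆ Y) (y : Vir) (x : X) : φ ⁅y, x⁆ = ⁅y, φ x⁆ :=
  φ.toLieModuleHom.map_lie y x

/-- The smooth vectors form a submodule, so in an irreducible module a single nonzero one suffices.
-/
theorem smoothVectors_eq_top_of_ne_zero (hX : LieModule.IsIrreducible ℂ Vir X) {x : X}
    (hx : x ≠ 0) (h : ∃ K : ℤ, ∀ n ≥ K, ⁅Vir.d n, x⁆ = 0) : smoothVectors X = ⊤ := by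
  refine (hX.eq_bot_or_eq_top _).resolve_left fun hbot => hx ?_
  have : x ∈ smoothVectors X := h
  rwa [hbot, LieSubmodule.mem_bot] at this

theorem smoothVectors_eq_top_of_equiv {Y : Type*} [AddCommGroup Y] [Module ℂ Y]
    [LieRingModule Vir Y] [LieModule ℂ Vir Y] (φ : X ≃ₗ⁅ℂ,Vir⁆ Y) (h : smoothVectors Y = ⊤) :
    smoothVectors X = ⊤ := by
  rw [eq_top_iff]
  intro x _
  have hx : φ x ∈ smoothVectors Y := h ▸ LieSubmodule.mem_top _
  obtain ⟨K, hK⟩ := hx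
  refine ⟨K, fun n hn => φ.injective ?_⟩
  rw [LieModuleEquiv.apply_lie, hK n hn, map_zero]

end Smooth

/-! ## Highest weight modules and induced modules are smooth -/

section Enveloping

attribute [local instance] LieRing.ofAssociativeRing

/-- A subalgebra of the enveloping algebra that contains the Lie algebra is everything. -/
theorem UniversalEnvelopingAlgebra.mem_of_ι_mem {L : Type*} [LieRing L] [LieAlgebra ℂ L]
    (S : Subalgebra ℂ (UniversalEnvelopingAlgebra ℂ L))
    (hS : ∀ x, UniversalEnvelopingAlgebra.ι ℂ x ∈ S) (u : UniversalEnvelopingAlgebra ℂ L) :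
    u ∈ S := by
  let f : L →ₗ⁅ℂ⁆ S :=
    { toFun := fun x => ⟨UniversalEnvelopingAlgebra.ι ℂ x, hS x⟩
      map_add' := fun x y => Subtype.ext (map_add _ x y)
      map_smul' := fun a x => Subtype.ext (map_smul _ a x)
      map_lie' := fun {x y} => Subtype.ext (LieHom.map_lie _ x y) }
  -- The composite of the induced map to `S` with the inclusion agrees with the identity on the Lie
  -- algebra, hence everywhere by the universal property.
  have h : S.val.comp (UniversalEnvelopingAlgebra.lift ℂ f) = AlgHom.id ℂ _ := by
    apply UniversalEnvelopingAlgebra.hom_ext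
    ext x
    change ((UniversalEnvelopingAlgebra.lift ℂ f (UniversalEnvelopingAlgebra.ι ℂ x) : S) :
      UniversalEnvelopingAlgebra ℂ L) = _
    rw [UniversalEnvelopingAlgebra.lift_ι_apply]
    rfl
  have h' := DFunLike.congr_fun h u
  rw [← show _ = u from h']
  exact (UniversalEnvelopingAlgebra.lift ℂ f u).2

variable {X : Type*} [AddCommGroup X] [Module ℂ X] [Module UVir X] [IsScalarTower ℂ UVir X]

/-- The elements of the enveloping algebra that preserve `S` form a subalgebra containing the Lie
algebra. This turns Lie submodules into `UVir`-stable subspaces. -/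
theorem smul_mem_of_ι_smul_mem (S : Submodule ℂ X)
    (hS : ∀ (y : Vir), ∀ x ∈ S, UniversalEnvelopingAlgebra.ι ℂ y • x ∈ S) (u : UVir) (x : X)
    (hx : x ∈ S) : u • x ∈ S := by
  let A : Subalgebra ℂ UVir :=
    { carrier := {u | ∀ x ∈ S, u • x ∈ S}
      mul_mem' := fun {a b} ha hb x hx => by rw [mul_smul]; exact ha _ (hb x hx)
      add_mem' := fun {a b} ha hb x hx => by
        rw [add_smul]; exact S.add_mem (ha x hx) (hb x hx)
      algebraMap_mem' := fun r x hx => by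
        rw [algebraMap_smul]; exact S.smul_mem r hx }
  exact UniversalEnvelopingAlgebra.mem_of_ι_mem A (fun y x hx => hS y x hx) u x hx

end Enveloping

/-- The module is generated by its highest weight vector, which all `d n` with `n > 0` kill. -/
theorem HighestWeight.smoothVectors_eq_top (θ h : ℂ) :
    smoothVectors (HighestWeight θ h) = ⊤ := by
  have key := smul_mem_of_ι_smul_mem (X := HighestWeight θ h)
    (smoothVectors (HighestWeight θ h)).toSubmodule
    (fun y x hx => (smoothVectors (HighestWeight θ h)).lie_mem (x := y) hx)
  let π : UVir →ₗ[UVir] HighestWeight θ h :=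
    (vermaRadical θ h).mkQ ∘ₗ (vermaIdeal θ h).mkQ
  have hπ : Function.Surjective π :=
    (Submodule.mkQ_surjective _).comp (Submodule.mkQ_surjective _)
  have h1 : π 1 ∈ smoothVectors (HighestWeight θ h) := by
    refine ⟨1, fun n hn => ?_⟩
    change UniversalEnvelopingAlgebra.ι ℂ (Vir.d n) • π 1 = 0
    rw [← map_smul, smul_eq_mul, mul_one]
    change (vermaRadical θ h).mkQ ((vermaIdeal θ h).mkQ _) = 0
    have : UniversalEnvelopingAlgebra.ι ℂ (Vir.d n) ∈ vermaIdeal θ h :=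
      Submodule.subset_span (Or.inl ⟨n, hn, rfl⟩)
    rw [Submodule.mkQ_apply, Submodule.mkQ_apply, (Submodule.Quotient.mk_eq_zero _).mpr this,
      Submodule.Quotient.mk_zero]
  rw [eq_top_iff]
  intro x _
  obtain ⟨u, rfl⟩ := hπ x
  have := key u _ h1
  rwa [← map_smul, smul_eq_mul, mul_one] at this

/-- The vectors `1 ⊗ n` generate the module, and `d i (1 ⊗ n) = 1 ⊗ d i n = 0` for `i > k`. -/
theorem IndTheta.smoothVectors_eq_top (N : Type*) [AddCommGroup N] [Module ℂ N]
    [LieRingModule VirPlus N] [LieModule ℂ VirPlus N] (θ : ℂ) (k : ℕ)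
    (hk : ∀ i > k, ∀ n : N, ⁅VirPlus.d i, n⁆ = 0) :
    smoothVectors (IndTheta N θ) = ⊤ := by
  have key := smul_mem_of_ι_smul_mem (X := IndTheta N θ)
    (smoothVectors (IndTheta N θ)).toSubmodule
    (fun y x hx => (smoothVectors (IndTheta N θ)).lie_mem (x := y) hx)
  let π : (UVir ⊗[ℂ] N) →ₗ[UVir] IndTheta N θ :=
    (centralSubmodule N θ).mkQ ∘ₗ (indRelations N).mkQ
  have hπ : Function.Surjective π :=
    (Submodule.mkQ_surjective _).comp (Submodule.mkQ_surjective _)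
  have h1 : ∀ n : N, π ((1 : UVir) ⊗ₜ[ℂ] n) ∈ smoothVectors (IndTheta N θ) := by
    intro n
    refine ⟨k + 1, fun i hi => ?_⟩
    lift i to ℕ using by omega
    change UniversalEnvelopingAlgebra.ι ℂ (Vir.d i) • π ((1 : UVir) ⊗ₜ[ℂ] n) = 0
    rw [← map_smul, TensorProduct.smul_tmul', smul_eq_mul, mul_one]
    change (centralSubmodule N θ).mkQ ((indRelations N).mkQ _) = 0
    have : UniversalEnvelopingAlgebra.ι ℂ (Vir.d i) ⊗ₜ[ℂ] n ∈ indRelations N := by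
      refine Submodule.subset_span ⟨VirPlus.d i, n, ?_⟩
      rw [hk i (by omega), TensorProduct.tmul_zero, sub_zero]
      rfl
    rw [Submodule.mkQ_apply, Submodule.mkQ_apply, (Submodule.Quotient.mk_eq_zero _).mpr this,
      Submodule.Quotient.mk_zero]
  rw [eq_top_iff]
  intro x _
  obtain ⟨z, rfl⟩ := hπ x
  induction z using TensorProduct.induction_on with
  | zero => rw [map_zero]; exact LieSubmodule.zero_mem _
  | add z z' h h' =>
    rw [map_add]
    exact add_mem (h (LieSubmodule.mem_top _)) (h' (LieSubmodule.mem_top _))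
  | tmul u n =>
    have := key u _ (h1 n)
    rwa [← map_smul, TensorProduct.smul_tmul', smul_eq_mul, mul_one] at this

/-! ## Irreducible tensor products -/

section TensorIrreducible

variable {A B : Type*} [AddCommGroup A] [Module ℂ A] [LieRingModule Vir A] [LieModule ℂ Vir A]
  [AddCommGroup B] [Module ℂ B] [LieRingModule Vir B] [LieModule ℂ Vir B]

theorem LieModule.IsIrreducible.nontrivial_of_vir (hA : LieModule.IsIrreducible ℂ Vir A) :
    Nontrivial A := by
  have := hA.toNontrivial
  exact (LieSubmodule.nontrivial_iff ℂ Vir A).mp this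

/-- A submodule `N` of `B` gives the submodule `A ⊗ N` of `A ⊗ B`. A contraction `ξ ⊗ id` with `ξ a
≠ 0` sends `A ⊗ N` into `N` and `a ⊗ b` to a nonzero multiple of `b`, so `N` is zero or everything
as soon as `A ⊗ N` is. -/
theorem isIrreducible_right_of_tensorProduct (h : LieModule.IsIrreducible ℂ Vir (A ⊗[ℂ] B)) :
    LieModule.IsIrreducible ℂ Vir B := by
  have hAB := h.nontrivial_of_vir
  have hA : Nontrivial A := by
    by_contra hA
    rw [not_nontrivial_iff_subsingleton] at hA
    exact not_subsingleton (A ⊗[ℂ] B) inferInstance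
  have hB : Nontrivial B := by
    by_contra hB
    rw [not_nontrivial_iff_subsingleton] at hB
    exact not_subsingleton (A ⊗[ℂ] B) inferInstance
  obtain ⟨a, ha⟩ := exists_ne (0 : A)
  obtain ⟨ξ, hξ⟩ : ∃ ξ : Module.Dual ℂ A, ξ a ≠ 0 := by
    by_contra! h0
    exact ha ((Module.forall_dual_apply_eq_zero_iff ℂ a).mp h0)
  let f : A ⊗[ℂ] B →ₗ[ℂ] B := (TensorProduct.lid ℂ B).toLinearMap ∘ₗ ξ.rTensor B
  have hf : ∀ a b, f (a ⊗ₜ b) = ξ a • b := fun a b => by simp [f]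
  refine LieModule.IsIrreducible.mk fun N hN => ?_
  let J : LieSubmodule ℂ Vir (A ⊗[ℂ] B) :=
    { toSubmodule := LinearMap.range (N.toSubmodule.subtype.lTensor A)
      lie_mem := by
        rintro x _ ⟨z, rfl⟩
        induction z using TensorProduct.induction_on with
        | zero => rw [map_zero, lie_zero]; exact Submodule.zero_mem _
        | add z z' h h' => rw [map_add, lie_add]; exact Submodule.add_mem _ h h'
        | tmul a n =>
          rw [LinearMap.lTensor_tmul, TensorProduct.LieModule.lie_tmul_right]
          exact Submodule.add_mem _ ⟨⁅x, a⁆ ⊗ₜ n, rfl⟩ ⟨a ⊗ₜ ⟨⁅x, n.1⁆, N.lie_mem n.2⟩, rfl⟩ }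
  have hJ : ∀ z ∈ J, f z ∈ N := by
    rintro _ ⟨z, rfl⟩
    induction z using TensorProduct.induction_on with
    | zero => rw [map_zero, map_zero]; exact N.zero_mem
    | add z z' h h' => rw [map_add, map_add]; exact N.add_mem h h'
    | tmul a n =>
      rw [LinearMap.lTensor_tmul, hf]
      exact N.smul_mem _ n.2
  rcases h.eq_bot_or_eq_top J with hbot | htop
  · refine absurd ?_ hN
    rw [LieSubmodule.eq_bot_iff]
    intro n hn
    have h1 : a ⊗ₜ n ∈ J := ⟨a ⊗ₜ ⟨n, hn⟩, rfl⟩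
    rw [hbot, LieSubmodule.mem_bot] at h1
    have h2 := hf a n
    rw [h1, map_zero] at h2
    exact (smul_eq_zero.mp h2.symm).resolve_left hξ
  · rw [eq_top_iff]
    intro b _
    have h1 := hJ (a ⊗ₜ b) (htop ▸ LieSubmodule.mem_top _)
    rw [hf] at h1
    have h2 := N.smul_mem (ξ a)⁻¹ h1
    rwa [smul_smul, inv_mul_cancel₀ hξ, one_smul] at h2

theorem isIrreducible_of_equiv (φ : A ≃ₗ⁅ℂ,Vir⁆ B) (h : LieModule.IsIrreducible ℂ Vir A) :
    LieModule.IsIrreducible ℂ Vir B := by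
  have hA := h.nontrivial_of_vir
  have : Nontrivial B := φ.injective.nontrivial
  refine LieModule.IsIrreducible.mk fun N hN => ?_
  rcases h.eq_bot_or_eq_top (N.comap φ.toLieModuleHom) with hbot | htop
  · refine absurd ?_ hN
    rw [LieSubmodule.eq_bot_iff]
    intro n hn
    have h1 : φ.symm n ∈ N.comap φ.toLieModuleHom := by
      rw [LieSubmodule.mem_comap]
      change φ (φ.symm n) ∈ N
      rwa [LieModuleEquiv.apply_symm_apply]
    rw [hbot, LieSubmodule.mem_bot] at h1
    rw [← φ.apply_symm_apply n, h1, map_zero]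
  · rw [eq_top_iff]
    intro b _
    have h1 : φ.symm b ∈ N.comap φ.toLieModuleHom := htop ▸ LieSubmodule.mem_top _
    rw [LieSubmodule.mem_comap] at h1
    change φ (φ.symm b) ∈ N at h1
    rwa [LieModuleEquiv.apply_symm_apply] at h1

theorem isIrreducible_left_of_tensorProduct (h : LieModule.IsIrreducible ℂ Vir (A ⊗[ℂ] B)) :
    LieModule.IsIrreducible ℂ Vir A := by
  let φ : A ⊗[ℂ] B ≃ₗ⁅ℂ,Vir⁆ B ⊗[ℂ] A :=
    { TensorProduct.comm ℂ A B with
      map_lie' := by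
        intro x z
        change TensorProduct.comm ℂ A B ⁅x, z⁆ = ⁅x, TensorProduct.comm ℂ A B z⁆
        induction z using TensorProduct.induction_on with
        | zero => simp
        | add z z' h h' => simp only [lie_add, map_add, h, h']
        | tmul a b =>
          simp only [TensorProduct.LieModule.lie_tmul_right, map_add, TensorProduct.comm_tmul]
          rw [add_comm] }
  exact isIrreducible_right_of_tensorProduct (isIrreducible_of_equiv φ h)

end TensorIrreducible

/-! ## Irreducible modules that are locally finite over a positive part are smooth -/

section LocallyFinite

variable {V : Type*} [AddCommGroup V] [Module ℂ V] [LieRingModule Vir V] [LieModule ℂ Vir V]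

theorem Vir.lie_d_natCast (i j : ℕ) :
    ⁅Vir.d i, Vir.d j⁆ = ((j : ℂ) - i) • Vir.d ((i + j : ℕ) : ℤ) :=
  congrArg Subtype.val (VirPlus.lie_d_d i j)

theorem Vir.lie_lie_d_natCast (i j : ℕ) (x : V) :
    ⁅Vir.d i, ⁅Vir.d j, x⁆⁆ - ⁅Vir.d j, ⁅Vir.d i, x⁆⁆ =
      ((j : ℂ) - i) • ⁅Vir.d ((i + j : ℕ) : ℤ), x⁆ := by
  rw [← smul_lie, ← Vir.lie_d_natCast, lie_lie]

/-- Local finiteness is a condition on single vectors; sums of stable finite-dimensional subspaces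
extend it to finitely generated ones. -/
theorem ActsLocallyFinitely.exists_stable {n : ℤ} (h : ActsLocallyFinitely V n)
    (S : Submodule ℂ V) (hS : S.FG) :
    ∃ T : Submodule ℂ V, T.FG ∧ S ≤ T ∧ ∀ y ∈ T, ⁅Vir.d n, y⁆ ∈ T := by
  induction S, hS using Submodule.fg_induction with
  | singleton x =>
    obtain ⟨T, hT, hx, hT'⟩ := h x
    exact ⟨T, Module.Finite.iff_fg.mp hT, (Submodule.span_singleton_le_iff_mem _ _).mpr hx, hT'⟩
  | sup S S' _ _ hS hS' =>
    obtain ⟨T, hT, hST, hT'⟩ := hS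
    obtain ⟨U, hU, hSU, hU'⟩ := hS'
    refine ⟨T ⊔ U, hT.sup hU, sup_le_sup hST hSU, fun y hy => ?_⟩
    obtain ⟨t, ht, u, hu, rfl⟩ := Submodule.mem_sup.mp hy
    rw [lie_add]
    exact Submodule.add_mem_sup (hT' t ht) (hU' u hu)

/-- The vector `d i₁ (d i₂ (⋯ (d iᵣ w)))` for the list `[i₁, …, iᵣ]`. -/
noncomputable def Vir.monomialAct (L : List ℕ) (w : V) : V := L.foldr (fun (i : ℕ) x => ⁅Vir.d i, x⁆) w

open Vir

theorem Vir.monomialAct_cons (i : ℕ) (L : List ℕ) (w : V) :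
    monomialAct (i :: L) w = ⁅Vir.d i, monomialAct L w⁆ := rfl

theorem Vir.monomialAct_append (L L' : List ℕ) (w : V) :
    monomialAct (L ++ L') w = monomialAct L (monomialAct L' w) := List.foldr_append

/-- `monomialAct L` as a linear map. -/
noncomputable def Vir.monomialEnd (L : List ℕ) : Module.End ℂ V :=
  L.foldr (fun (i : ℕ) f => LieModule.toEnd ℂ Vir V (Vir.d i) * f) 1

theorem Vir.monomialEnd_apply (L : List ℕ) (w : V) : monomialEnd L w = monomialAct L w := by
  induction L with
  | nil => rfl
  | cons i L ih => rw [monomialAct_cons, ← ih]; rfl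

/-- The span of the vectors `monomialAct L w` for lists `L` of length at most `r` with entries at
least `N`. -/
noncomputable def Vir.filtration (N : ℕ) (w : V) (r : ℕ) : Submodule ℂ V :=
  Submodule.span ℂ {x | ∃ L : List ℕ, L.length ≤ r ∧ (∀ i ∈ L, N ≤ i) ∧ x = monomialAct L w}

theorem Vir.lie_mem_filtration {N : ℕ} {w : V} {r i : ℕ} (hi : N ≤ i) {x : V}
    (hx : x ∈ filtration N w r) : ⁅Vir.d i, x⁆ ∈ filtration N w (r + 1) := by
  induction hx using Submodule.span_induction with
  | zero => rw [lie_zero]; exact Submodule.zero_mem _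
  | add x y _ _ h h' => rw [lie_add]; exact Submodule.add_mem _ h h'
  | smul a x _ h => rw [lie_smul]; exact Submodule.smul_mem _ a h
  | mem x hx =>
    obtain ⟨L, hL, hL', rfl⟩ := hx
    exact Submodule.subset_span ⟨i :: L, by simpa using hL, by simpa using ⟨hi, hL'⟩, rfl⟩

/-- Up to shorter monomials, the order of the factors is irrelevant. -/
theorem Vir.monomialAct_sub_mem_of_perm {N : ℕ} {w : V} {L L' : List ℕ} (h : L.Perm L')
    (hL : ∀ i ∈ L, N ≤ i) (r : ℕ) (hr : L.length ≤ r + 1) :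
    monomialAct L w - monomialAct L' w ∈ filtration N w r := by
  induction h generalizing r with
  | nil => rw [sub_self]; exact Submodule.zero_mem _
  | @cons i L L' hp ih =>
    rw [List.forall_mem_cons] at hL
    rw [List.length_cons] at hr
    rcases r with _ | r
    · obtain rfl : L = [] := List.length_eq_zero_iff.mp (by omega)
      rw [hp.nil_eq, sub_self]
      exact Submodule.zero_mem _
    · rw [monomialAct_cons, monomialAct_cons, ← lie_sub]
      exact lie_mem_filtration hL.1 (ih hL.2 r (by omega))
  | swap i j L =>
    simp only [List.mem_cons, forall_eq_or_imp] at hL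
    simp only [List.length_cons] at hr
    rw [monomialAct_cons, monomialAct_cons, monomialAct_cons, monomialAct_cons,
      lie_lie_d_natCast, ← monomialAct_cons]
    refine Submodule.smul_mem _ _ (Submodule.subset_span ⟨_, ?_, ?_, rfl⟩)
    · rw [List.length_cons]; omega
    · rw [List.forall_mem_cons]
      exact ⟨by omega, hL.2.2⟩
  | trans h1 h2 ih1 ih2 =>
    have := Submodule.add_mem _ (ih1 hL r hr)
      (ih2 (fun i hi => hL i (h1.mem_iff.mpr hi)) r (by rw [← h1.length_eq]; exact hr))
    rwa [sub_add_sub_cancel] at this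

/-- Descending induction on the least allowed index `b`. In a sorted monomial the copies of `d b`
are outermost, so the rest lies in the space `S` found for `b + 1`, and a finite-dimensional `d
b`-stable space containing `S` absorbs them. -/
theorem exists_fg_mem_of_sorted {M : ℕ} (w : V) (n b : ℕ) (hn : b + n = M + 1)
    (hfin : ∀ i, b ≤ i → ActsLocallyFinitely V i) :
    ∃ S : Submodule ℂ V, S.FG ∧ ∀ L : List ℕ, L.SortedLE → (∀ i ∈ L, b ≤ i ∧ i ≤ M) →
      monomialAct L w ∈ S := by
  induction n generalizing b with
  | zero =>
    refine ⟨Submodule.span ℂ {w}, Submodule.fg_span_singleton w, fun L _ hL => ?_⟩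
    rcases L with _ | ⟨i, L⟩
    · exact Submodule.mem_span_singleton_self w
    · have := hL i List.mem_cons_self
      omega
  | succ n ih =>
    obtain ⟨S, hS, hS'⟩ := ih (b + 1) (by omega) fun i hi => hfin i (by omega)
    obtain ⟨T, hT, hST, hT'⟩ := (hfin b le_rfl).exists_stable S hS
    refine ⟨T, hT, fun L hs hL => ?_⟩
    induction L with
    | nil => exact hST (hS' [] hs (by simp))
    | cons i L ihL =>
      rw [List.sortedLE_iff_pairwise, List.pairwise_cons] at hs
      have hi := hL i List.mem_cons_self
      rcases hi.1.eq_or_lt with rfl | hlt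
      · rw [monomialAct_cons]
        exact hT' _ (ihL (List.sortedLE_iff_pairwise.mpr hs.2)
          fun j hj => hL j (List.mem_cons_of_mem _ hj))
      · refine hST (hS' _ (List.sortedLE_iff_pairwise.mpr (List.pairwise_cons.mpr hs)) ?_)
        intro j hj
        refine ⟨?_, (hL j hj).2⟩
        rcases List.mem_cons.mp hj with rfl | hj
        · exact hlt
        · exact hlt.trans_le (hs.1 j hj)

/-- If the `d i w` with `i ≥ N` span a finite-dimensional space and the `d i` with `i ≥ N` are
locally finite, then they generate a finite-dimensional space from `w`. -/
theorem exists_fg_monomialAct_mem {N : ℕ} (w : V) (hfin : ∀ i, N ≤ i → ActsLocallyFinitely V i)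
    (hw : (Submodule.span ℂ {x : V | ∃ i, N ≤ i ∧ x = ⁅Vir.d (i : ℕ), w⁆}).FG) :
    ∃ S : Submodule ℂ V, S.FG ∧ ∀ L : List ℕ, (∀ i ∈ L, N ≤ i) → monomialAct L w ∈ S := by
  obtain ⟨t, ht, hts⟩ := (Submodule.fg_span_iff_fg_span_finset_subset _).mp hw
  obtain ⟨M, hM, hspan⟩ : ∃ M, N ≤ M + 1 ∧ ∀ i, N ≤ i →
      ⁅Vir.d (i : ℕ), w⁆ ∈ Submodule.span ℂ {x : V | ∃ i, (N ≤ i ∧ i ≤ M) ∧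
        x = ⁅Vir.d (i : ℕ), w⁆} := by
    have ht' : ∀ x ∈ t, ∃ i, N ≤ i ∧ x = ⁅Vir.d (i : ℕ), w⁆ := fun x hx => ht hx
    choose! f hf using ht'
    -- `f` picks an index for each member of a finite spanning set; `M` bounds these indices.
    refine ⟨N + t.sup f, by omega, fun i hi => ?_⟩
    have h1 : ⁅Vir.d (i : ℕ), w⁆ ∈ Submodule.span ℂ {x : V | ∃ i, N ≤ i ∧ x = ⁅Vir.d (i : ℕ), w⁆} :=
      Submodule.subset_span ⟨i, hi, rfl⟩
    rw [hts] at h1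
    refine Submodule.span_mono ?_ h1
    intro x hx
    exact ⟨f x, ⟨(hf x hx).1, (Finset.le_sup hx).trans (Nat.le_add_left _ _)⟩, (hf x hx).2⟩
  obtain ⟨S, hS, hS'⟩ := exists_fg_mem_of_sorted (M := M) w (M + 1 - N) N (by omega) hfin
  refine ⟨S, hS, ?_⟩
  have hfil : ∀ r, filtration N w r ≤ S := by
    intro r
    induction r with
    | zero =>
      refine Submodule.span_le.mpr ?_
      rintro x ⟨L, hL, -, rfl⟩
      obtain rfl : L = [] := List.length_eq_zero_iff.mp (by omega)
      exact hS' [] (List.sortedLE_iff_pairwise.mpr List.Pairwise.nil) (by simp)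
    | succ r ih =>
      -- `A` holds the factors whose index is already at most `M`, and `B` those still to be
      -- treated. The head of `B` is moved next to `w`, the vector `d i w` is rewritten through the
      -- `d j w` with `j ≤ M`, and each such `d j` is moved to the front of `A`. When `B` is empty,
      -- `A` is sorted. Every reordering costs only shorter monomials, which lie in `S` by induction
      -- on the length.
      have key : ∀ B A : List ℕ, A.length + B.length ≤ r + 1 → (∀ i ∈ A, N ≤ i ∧ i ≤ M) →
          (∀ i ∈ B, N ≤ i) → monomialAct (A ++ B) w ∈ S := by
        intro B
        induction B with
        | nil =>
          intro A hAB hA _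
          rw [List.append_nil]
          have hp := List.mergeSort_perm A (· ≤ ·)
          have h1 := ih (monomialAct_sub_mem_of_perm (w := w) hp.symm (fun i hi => (hA i hi).1) r
            (by simpa using hAB))
          have h2 := hS' (A.mergeSort (· ≤ ·)) (List.sortedLE_mergeSort)
            fun i hi => hA i (hp.mem_iff.mp hi)
          have := S.add_mem h1 h2
          rwa [sub_add_cancel] at this
        | cons i B ihB =>
          intro A hAB hA hB
          rw [List.forall_mem_cons] at hB
          rw [List.length_cons] at hAB
          have hN : ∀ j ∈ A ++ B, N ≤ j := fun j hj =>
            (List.mem_append.mp hj).elim (fun h => (hA j h).1) (hB.2 j)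
          have hp : (A ++ i :: B).Perm ((A ++ B) ++ [i]) :=
            List.perm_middle.trans (List.perm_append_singleton i (A ++ B)).symm
          have h1 := ih (monomialAct_sub_mem_of_perm (w := w) hp (fun j hj => by
            rcases List.mem_append.mp (hp.mem_iff.mp hj) with h | h
            · exact hN j h
            · rw [List.mem_singleton.mp h]; exact hB.1) r (by simp; omega))
          have h2 : monomialAct ((A ++ B) ++ [i]) w ∈ S := by
            rw [monomialAct_append]
            have h3 : ∀ x ∈ Submodule.span ℂ {x : V | ∃ i, (N ≤ i ∧ i ≤ M) ∧
                x = ⁅Vir.d (i : ℕ), w⁆}, monomialAct (A ++ B) x ∈ S := by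
              intro x hx
              rw [← monomialEnd_apply]
              revert x
              change Submodule.span ℂ _ ≤ S.comap (monomialEnd (A ++ B))
              refine Submodule.span_le.mpr ?_
              rintro x ⟨j, hj, rfl⟩
              change monomialEnd (A ++ B) _ ∈ S
              rw [monomialEnd_apply]
              change monomialAct (A ++ B) (monomialAct [j] w) ∈ S
              rw [← monomialAct_append]
              have hp' : ((A ++ B) ++ [j]).Perm ((j :: A) ++ B) :=
                List.perm_append_singleton j (A ++ B)
              have h4 := ih (monomialAct_sub_mem_of_perm (w := w) hp' (fun l hl => by
                rcases List.mem_append.mp hl with h | h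
                · exact hN l h
                · rw [List.mem_singleton.mp h]; exact hj.1) r (by simp; omega))
              have h5 := ihB (j :: A) (by rw [List.length_cons]; omega)
                (by rw [List.forall_mem_cons]; exact ⟨hj, hA⟩) hB.2
              have := S.add_mem h4 h5
              rwa [sub_add_cancel] at this
            exact h3 _ (hspan i hB.1)
          have := S.add_mem h1 h2
          rwa [sub_add_cancel] at this
      refine Submodule.span_le.mpr ?_
      rintro x ⟨L, hL, hL', rfl⟩
      exact key L [] (by simpa using hL) (by simp) hL'
  intro L hL
  exact hfil L.length (Submodule.subset_span ⟨L, le_rfl, hL, rfl⟩)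

/-- A stable finite-dimensional subspace over `ℂ` contains an eigenvector. -/
theorem exists_eigenvector [Nontrivial V] {n : ℤ} (h : ActsLocallyFinitely V n) :
    ∃ (w : V) (μ : ℂ), w ≠ 0 ∧ ⁅Vir.d n, w⁆ = μ • w := by
  obtain ⟨x, hx⟩ := exists_ne (0 : V)
  obtain ⟨S, hS, hxS, hS'⟩ := h x
  have : Nontrivial S := ⟨⟨x, hxS⟩, 0, fun h => hx (congrArg Subtype.val h)⟩
  let f : Module.End ℂ S := (LieModule.toEnd ℂ Vir V (Vir.d n)).restrict hS'
  obtain ⟨μ, hμ⟩ := Module.End.exists_eigenvalue f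
  obtain ⟨w, hw⟩ := hμ.exists_hasEigenvector
  refine ⟨w, μ, fun h => hw.2 (Subtype.ext h), ?_⟩
  exact congrArg Subtype.val hw.apply_eq_smul

/-- The bracket relation gives `(j - N) d (N + j) w = (d N - μ) d j w`, so for `j ≠ N` the vector `d
(N + j) w` is obtained from `d j w` inside any `d N`-stable space. Starting from the indices `N, …,
2 N` yields all larger ones. -/
theorem fg_span_lie_of_eigenvector {N : ℕ} (hN : 0 < N) (w : V) (μ : ℂ)
    (hw : ⁅Vir.d N, w⁆ = μ • w) (h : ActsLocallyFinitely V N) :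
    (Submodule.span ℂ {x : V | ∃ i, N ≤ i ∧ x = ⁅Vir.d (i : ℕ), w⁆}).FG := by
  let S₀ : Submodule ℂ V := Submodule.span ℂ
    ((fun i : ℕ => ⁅Vir.d i, w⁆) '' Set.Icc N (2 * N))
  obtain ⟨T, hT, hST, hT'⟩ := h.exists_stable S₀
    (Submodule.fg_span ((Set.finite_Icc _ _).image _))
  have hmem : ∀ i, N ≤ i → ⁅Vir.d (i : ℕ), w⁆ ∈ T := by
    intro i
    induction i using Nat.strong_induction_on with
    | _ i ih =>
      intro hi
      by_cases hi2 : i ≤ 2 * N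
      · refine hST (Submodule.subset_span ⟨i, ⟨hi, hi2⟩, rfl⟩)
      -- Beyond `2 N` one has `j > N`, so the coefficient `j - N` is invertible; at `i = 2 N` it
      -- would vanish.
      · obtain ⟨j, rfl⟩ : ∃ j, i = N + j := ⟨i - N, by omega⟩
        have h1 := ih j (by omega) (by omega)
        have h2 := Vir.lie_lie_d_natCast N j w
        rw [hw, lie_smul] at h2
        have h3 : ((j : ℂ) - N) ≠ 0 := by
          rw [sub_ne_zero]
          exact_mod_cast (by omega : j ≠ N)
        have h4 : ⁅Vir.d ((N + j : ℕ) : ℤ), w⁆ = ((j : ℂ) - N)⁻¹ •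
            (⁅Vir.d N, ⁅Vir.d j, w⁆⁆ - μ • ⁅Vir.d (j : ℕ), w⁆) := by
          rw [h2, smul_smul, inv_mul_cancel₀ h3, one_smul]
        rw [h4]
        exact T.smul_mem _ (T.sub_mem (hT' _ h1) (T.smul_mem _ h1))
  have : FiniteDimensional ℂ T := Module.Finite.iff_fg.mpr hT
  refine Module.Finite.iff_fg.mp (Submodule.finiteDimensional_of_le (S₂ := T) ?_)
  refine Submodule.span_le.mpr ?_
  rintro x ⟨i, hi, rfl⟩
  exact hmem i hi

/-- Linearly dependent operators with the commutation relations of the `d (N + i)`: one of them is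
zero. -/
theorem exists_eq_zero_of_comm {A : Type*} [Ring A] [Algebra ℂ A] (N : ℕ) (R : ℕ → A)
    (hR : ∀ i j, R i * R j - R j * R i = ((j : ℂ) - i) • R (i + (j + N))) (x : ℕ →₀ ℂ) (hx : x ≠ 0)
    (h0 : Finsupp.linearCombination ℂ R x = 0) : ∃ m, R m = 0 := by
  induction hn : x.support.card using Nat.strong_induction_on generalizing x with
  | _ n ih =>
    obtain ⟨m, hm⟩ := Finsupp.support_nonempty_iff.mpr hx
    -- The commutator of `R m` with the relation `∑ x i • R i = 0` is a new relation, with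
    -- coefficients `x i (i - m)` at the shifted indices `m + (i + N)`. The term `i = m` drops out,
    -- so the support shrinks.
    let x' : ℕ →₀ ℂ := Finsupp.onFinset x.support (fun i => x i * ((i : ℂ) - m)) fun i hi =>
      Finsupp.mem_support_iff.mpr (left_ne_zero_of_mul hi)
    have hx' : ∀ i, x' i = x i * ((i : ℂ) - m) := fun i => rfl
    have hsub : x'.support ⊆ x.support.erase m := by
      intro i hi
      rw [Finsupp.mem_support_iff, hx'] at hi
      refine Finset.mem_erase.mpr ⟨?_, Finsupp.mem_support_iff.mpr (left_ne_zero_of_mul hi)⟩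
      rintro rfl
      simp at hi
    by_cases hzero : x' = 0
    · refine ⟨m, ?_⟩
      have hs : x = Finsupp.single m (x m) := by
        ext i
        by_cases hi : i = m
        · subst hi; simp
        · rw [Finsupp.single_eq_of_ne hi]
          have := hx' i
          rw [hzero, Finsupp.zero_apply] at this
          refine (mul_eq_zero.mp this.symm).resolve_right ?_
          refine sub_ne_zero.mpr ?_
          exact_mod_cast hi
      rw [hs, Finsupp.linearCombination_single] at h0
      exact (smul_eq_zero.mp h0).resolve_left (Finsupp.mem_support_iff.mp hm)
    · let e : ℕ ↪ ℕ := ⟨fun i => m + (i + N), fun i j hij => by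
        have : m + (i + N) = m + (j + N) := hij
        omega⟩
      refine ih _ ?_ (x'.embDomain e) ?_ ?_ rfl
      · rw [Finsupp.support_embDomain, Finset.card_map, ← hn]
        exact (Finset.card_le_card hsub).trans_lt (Finset.card_erase_lt_of_mem hm)
      · rwa [Ne, Finsupp.embDomain_eq_zero]
      · have h1 : R m * Finsupp.linearCombination ℂ R x - Finsupp.linearCombination ℂ R x * R m =
            Finsupp.linearCombination ℂ R (x'.embDomain e) := by
          rw [Finsupp.linearCombination_embDomain, Finsupp.linearCombination_apply,
            Finsupp.linearCombination_apply, Finsupp.sum,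
            Finsupp.sum_of_support_subset x' (hsub.trans (Finset.erase_subset _ _)) _ (by simp),
            Finset.mul_sum, Finset.sum_mul, ← Finset.sum_sub_distrib]
          refine Finset.sum_congr rfl fun i _ => ?_
          rw [mul_smul_comm, smul_mul_assoc, ← smul_sub, hR, hx', smul_smul]
          rfl
        rw [← h1, h0, mul_zero, zero_mul, sub_zero]

/-- An irreducible module on which the `d n` are locally finite for large `n` is smooth. -/
theorem EventuallyLocallyFinite.smoothVectors_eq_top (hV : LieModule.IsIrreducible ℂ Vir V)
    (h : EventuallyLocallyFinite V) : smoothVectors V = ⊤ := by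
  have := hV.nontrivial_of_vir
  obtain ⟨K, hK⟩ := h
  set N := K + 1 with hN
  have hfin : ∀ i, N ≤ i → ActsLocallyFinitely V i := fun i hi => hK i (by omega)
  obtain ⟨w, μ, hw0, hw⟩ := exists_eigenvector (hfin N le_rfl)
  obtain ⟨S, hS, hS'⟩ := exists_fg_monomialAct_mem w hfin
    (fg_span_lie_of_eigenvector (by omega) w μ hw (hfin N le_rfl))
  refine smoothVectors_eq_top_of_ne_zero hV hw0 ?_
  let W : Submodule ℂ V := Submodule.span ℂ {x | ∃ L : List ℕ, (∀ i ∈ L, N ≤ i) ∧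
    x = monomialAct L w}
  have hWS : W ≤ S := by
    refine Submodule.span_le.mpr ?_
    rintro x ⟨L, hL, rfl⟩
    exact hS' L hL
  have hwW : w ∈ W := Submodule.subset_span ⟨[], by simp, rfl⟩
  have hstab : ∀ i : ℕ, ∀ x ∈ W, ⁅Vir.d ((N + i : ℕ) : ℤ), x⁆ ∈ W := by
    intro i x hx
    induction hx using Submodule.span_induction with
    | zero => rw [lie_zero]; exact Submodule.zero_mem _
    | add x y _ _ h h' => rw [lie_add]; exact Submodule.add_mem _ h h'
    | smul a x _ h => rw [lie_smul]; exact Submodule.smul_mem _ a h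
    | mem x hx =>
      obtain ⟨L, hL, rfl⟩ := hx
      exact Submodule.subset_span ⟨(N + i) :: L, by
        rw [List.forall_mem_cons]; exact ⟨by omega, hL⟩, rfl⟩
  have : FiniteDimensional ℂ S := Module.Finite.iff_fg.mpr hS
  have : FiniteDimensional ℂ W := Submodule.finiteDimensional_of_le hWS
  let R : ℕ → Module.End ℂ W := fun i =>
    (LieModule.toEnd ℂ Vir V (Vir.d ((N + i : ℕ) : ℤ))).restrict (hstab i)
  have hR : ∀ i j, R i * R j - R j * R i = ((j : ℂ) - i) • R (i + (j + N)) := by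
    intro i j
    ext x
    have := Vir.lie_lie_d_natCast (N + i) (N + j) (x : V)
    rw [show N + i + (N + j) = N + (i + (j + N)) by ring] at this
    push_cast at this
    rw [add_sub_add_left_eq_sub] at this
    change _ = ((j : ℂ) - i) • ⁅Vir.d ((N + (i + (j + N)) : ℕ) : ℤ), (x : V)⁆
    push_cast
    rw [← this]
    rfl
  -- `W` is finite-dimensional, so its endomorphism algebra is too and cannot contain an infinite
  -- independent family.
  have hdep : ¬ LinearIndependent ℂ R := fun hli => by
    have := hli.finite
    exact not_finite ℕ
  rw [linearIndependent_iff] at hdep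
  push Not at hdep
  obtain ⟨x, hx0, hx⟩ := hdep
  obtain ⟨m, hm⟩ := exists_eq_zero_of_comm N R hR x hx hx0
  -- Once `R m = 0`, its commutator with `R i` shows that `R (m + i + N) = 0` for `i ≠ m`. The bound
  -- restricts to `i ≥ m + 1`.
  refine ⟨N + (m + ((m + 1) + N) : ℕ), fun n hn => ?_⟩
  obtain ⟨i, hi, rfl⟩ : ∃ i : ℕ, m + 1 ≤ i ∧ n = ((N + (m + (i + N)) : ℕ) : ℤ) :=
    ⟨(n - N - m - N).toNat, by omega, by omega⟩
  have h1 := hR m i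
  rw [hm, zero_mul, mul_zero, sub_zero] at h1
  have h2 := (smul_eq_zero.mp h1.symm).resolve_left (by
    refine sub_ne_zero.mpr ?_
    exact_mod_cast (by omega : i ≠ m))
  exact congrArg Subtype.val (DFunLike.congr_fun h2 ⟨w, hwW⟩)

end LocallyFinite

/-! ## Properties of the modules `Ω(λ, α, h)` -/

namespace Omega

variable (lam : ℂˣ) (α : ℂ) (h : ℂ[X])

theorem lie_d (m : ℤ) (x : Omega lam α h) : ⁅Vir.d m, x⁆ = op lam α h m x := by
  change chargelessRep (op lam α h) (Vir.d m) x = _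
  rw [chargelessRep_d]

theorem lie_c (x : Omega lam α h) : ⁅Vir.c, x⁆ = 0 := by
  change chargelessRep (op lam α h) Vir.c x = _
  rw [chargelessRep_c]
  rfl

/-- The coefficient of `m ^ 2` in `coeffOp α h m`. -/
noncomputable def quadOp : ℂ[X] →ₗ[ℂ] ℂ[X] :=
  α • (Polynomial.derivative - LinearMap.mulLeft ℂ (divDiff α h))

/-- The coefficient of `m` in `coeffOp α h m`. -/
noncomputable def linOp : ℂ[X] →ₗ[ℂ] ℂ[X] :=
  LinearMap.mulLeft ℂ (h + Polynomial.C α * divDiff α h) -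
    LinearMap.mulLeft ℂ Polynomial.X ∘ₗ Polynomial.derivative

theorem coeffOp_eq (m : ℤ) :
    coeffOp α h m = (m : ℂ) ^ 2 • quadOp α h + (m : ℂ) ^ 1 • linOp α h := by
  refine LinearMap.ext fun f => ?_
  simp only [coeffOp, quadOp, linOp, LinearMap.sub_apply, LinearMap.add_apply,
    LinearMap.smul_apply, LinearMap.comp_apply, LinearMap.mulLeft_apply,
    Polynomial.smul_eq_C_mul, Polynomial.C_mul, Polynomial.C_sub, Polynomial.C_pow,
    Polynomial.C_1]
  ring

theorem polyTop_coeffOp : PolyTop 2 (quadOp α h) (coeffOp α h) := by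
  have := (polyTop_monomial 2 (quadOp α h)).add_polyLT (polyLT_monomial one_lt_two (linOp α h))
  convert this using 1
  ext1 m
  exact coeffOp_eq α h m

/-- The inclusion of `ℂ[t]` in `ℂ[t, s]` as a linear map. -/
noncomputable def incl : ℂ[X] →ₗ[ℂ] ℂ[X][X] :=
  (Polynomial.CAlgHom (R := ℂ) (A := ℂ[X])).toLinearMap

theorem incl_apply (f : ℂ[X]) : incl f = Polynomial.C f := rfl

theorem C_C_mul (a : ℂ) (q : ℂ[X][X]) : Polynomial.C (Polynomial.C a) * q = a • q := by
  rw [← Polynomial.smul_eq_C_mul, ← algebraMap_smul ℂ[X] a q]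
  rfl

theorem op_incl (m : ℤ) (f : ℂ[X]) : op lam α h m (incl f) =
    (lam : ℂ) ^ m • (Polynomial.X * incl f + incl (coeffOp α h m f)) := by
  rw [incl_apply, op_C, C_C_mul]
  rfl

theorem op_op_incl (l m : ℤ) (f : ℂ[X]) : op lam α h (l - m) (op lam α h m (incl f)) =
    (lam : ℂ) ^ l • (incl (coeffOp α h (l - m) (coeffOp α h m f)) +
      (Polynomial.X * incl (coeffOp α h m f) +
        (Polynomial.X * (Polynomial.X * incl f + incl (coeffOp α h (l - m) f)) -
          ((l - m : ℤ) : ℂ) • (Polynomial.X * incl f + incl (coeffOp α h (l - m) f))))) := by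
  have e : (lam : ℂ) ^ l = (lam : ℂ) ^ m * (lam : ℂ) ^ (l - m) := by
    rw [← zpow_add₀ lam.ne_zero, add_sub_cancel]
  rw [op_incl, map_smul, map_add, op_X_mul, op_incl, op_incl, sub_mul, C_C_mul, e, mul_smul]
  congr 1
  rw [mul_smul_comm, smul_comm _ ((lam : ℂ) ^ (l - m)), ← smul_sub, ← smul_add]
  congr 1
  abel

/-- Only the composite of the two quadratic operators reaches degree `4`; each term with a factor
`s` or an explicit `l - m` has degree at most `3`. Replacing `m` by `l - m` keeps the sign of the
quadratic coefficient. -/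
theorem polyTop_op_op_incl (l : ℤ) (f : ℂ[X]) :
    PolyTop 4 ((lam : ℂ) ^ l • incl (quadOp α h (quadOp α h f)))
      (fun m => op lam α h (l - m) (op lam α h m (incl f))) := by
  simp only [op_op_incl]
  refine PolyTop.const_smul _ ?_
  have h1 : PolyTop 2 (quadOp α h f) (fun m => coeffOp α h m f) :=
    (polyTop_coeffOp α h).apply_const f
  have h2 := PolyTop.reflect_of_even l even_two (polyTop_coeffOp α h)
  have h3 : PolyTop 2 (quadOp α h f) (fun m => coeffOp α h (l - m) f) :=
    h2.apply_const f
  have h4 := (h2.apply h1).map incl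
  have h5 : PolyTop 2 (incl (quadOp α h f)) (fun m => Polynomial.X * incl f +
      incl (coeffOp α h (l - m) f)) := by
    have := (h3.map incl).add_polyLT (polyLT_monomial two_pos (Polynomial.X * incl f))
    convert this using 1
    ext1 m
    rw [pow_zero, one_smul, add_comm]
  refine h4.add_polyLT ?_
  have h6 := (h1.map incl).map (LinearMap.mulLeft ℂ (Polynomial.X : ℂ[X][X]))
  have h7 := h5.map (LinearMap.mulLeft ℂ (Polynomial.X : ℂ[X][X]))
  have h8 := (polyTop_sub_intCast l).smul h5
  exact Submodule.add_mem _ (h6.mem_polyLT (by omega))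
    (Submodule.sub_mem _ (h7.mem_polyLT (by omega)) (h8.mem_polyLT (by omega)))

/-- If `Q ^ 2 = 0`, applying it to `1` gives `q ^ 2 = q'`. Degrees force `q` to be constant, hence
zero, and then `Q ^ 2 = α ^ 2 d²/dt²` does not kill `t ^ 2`. -/
theorem exists_quadOp_ne_zero (hα : α ≠ 0) : ∃ f, quadOp α h (quadOp α h f) ≠ 0 := by
  by_contra! h0
  set q := divDiff α h with hq
  have key : ∀ f : ℂ[X], Polynomial.derivative (Polynomial.derivative f - q * f) -
      q * (Polynomial.derivative f - q * f) = 0 := by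
    intro f
    have := h0 f
    simp only [quadOp, LinearMap.smul_apply, LinearMap.sub_apply, LinearMap.mulLeft_apply,
      map_smul, smul_smul, ← hq] at this
    exact (smul_eq_zero.mp this).resolve_left (mul_ne_zero hα hα)
  have h1 := key 1
  simp only [Polynomial.derivative_one, mul_one, zero_sub, Polynomial.derivative_neg, mul_neg,
    sub_neg_eq_add] at h1
  have h2 : q * q = Polynomial.derivative q := by linear_combination h1
  have h3 : q = 0 := by
    have h4 := congrArg Polynomial.natDegree h2
    rw [← sq, Polynomial.natDegree_pow] at h4
    have h5 := Polynomial.natDegree_derivative_le q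
    have h6 : q.natDegree = 0 := by omega
    rw [Polynomial.eq_C_of_natDegree_eq_zero h6, Polynomial.derivative_C,
      ← Polynomial.eq_C_of_natDegree_eq_zero h6] at h2
    exact mul_self_eq_zero.mp h2
  have h4 := key (Polynomial.X ^ 2)
  rw [h3] at h4
  have h5 := congrArg (Polynomial.eval 0) h4
  simp at h5

/-- The coefficient of `s` in `d n 1` is `λ ^ n`. -/
theorem op_incl_one_ne_zero (n : ℤ) : op lam α h n (incl 1) ≠ 0 := by
  intro h0
  rw [op_incl] at h0
  have h1 := (smul_eq_zero.mp h0).resolve_left (zpow_ne_zero n lam.ne_zero)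
  have h2 := congrArg (fun p => Polynomial.coeff p 1) h1
  simp [incl_apply] at h2

/-- On `f(t) s ^ i` the action is `λ ^ m (s - m) ^ i` times an expression quadratic in `m`. This is
used to recover `λ` from the action. -/
theorem op_zpow_smul_polyLT (p : ℂ[X][X]) :
    ∃ d, ∃ u ∈ PolyLT ℂ[X][X] d, ∀ m, op lam α h m p = (lam : ℂ) ^ m • u m := by
  induction p using Polynomial.induction_on' with
  | add p q hp hq =>
    obtain ⟨d, u, hu, hu'⟩ := hp
    obtain ⟨e, v, hv, hv'⟩ := hq
    refine ⟨max d e, u + v, Submodule.add_mem _ (polyLT_mono (le_max_left _ _) hu)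
      (polyLT_mono (le_max_right _ _) hv), fun m => ?_⟩
    rw [map_add, hu', hv', Pi.add_apply, smul_add]
  | monomial i f =>
    have h1 : PolyTop 1 (-1 : ℂ[X][X])
        (fun m : ℤ => Polynomial.X - Polynomial.C (Polynomial.C (m : ℂ))) := by
      have := (polyTop_monomial 1 (-1 : ℂ[X][X])).add_polyLT
        (polyLT_monomial one_pos (Polynomial.X : ℂ[X][X]))
      convert this using 1
      ext1 m
      rw [← C_C_mul, ← C_C_mul, pow_zero, pow_one, Polynomial.C_1, Polynomial.C_1]
      ring
    have h2 : PolyTop 2 (incl (quadOp α h f)) (fun m => Polynomial.X * incl f +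
        incl (coeffOp α h m f)) := by
      have := (((polyTop_coeffOp α h).apply_const f).map incl).add_polyLT
        (polyLT_monomial two_pos (Polynomial.X * incl f))
      convert this using 1
      ext1 m
      rw [pow_zero, one_smul, add_comm]
    refine ⟨_, _, ((h1.pow i).mul h2).mem_polyLT (Nat.lt_succ_self _), fun m => ?_⟩
    have h3 := op_shift_pow_mul lam α h m 0 i (Polynomial.C f)
    rw [Polynomial.C_0, Polynomial.C_0, sub_zero, sub_zero] at h3
    rw [← Polynomial.C_mul_X_pow_eq_monomial, mul_comm, h3, ← incl_apply f, op_incl, mul_smul_comm]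

theorem eq_bot_or_eq_top_of_op_mem (hI : LieModule.IsIrreducible ℂ Vir (Omega lam α h))
    (J : Submodule ℂ ℂ[X][X]) (hJ : ∀ m, ∀ p ∈ J, op lam α h m p ∈ J) : J = ⊥ ∨ J = ⊤ := by
  let J' : Submodule ℂ (Omega lam α h) := J
  let I : LieSubmodule ℂ Vir (Omega lam α h) :=
    { toSubmodule := J'
      lie_mem := by
        intro y p hp
        change ⁅y, p⁆ ∈ J'
        induction y using Vir.induction with
        | hd i => rw [lie_d]; exact hJ i p hp
        | hc => rw [lie_c]; exact J'.zero_mem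
        | hadd x y hx hy => rw [add_lie]; exact J'.add_mem hx hy
        | hsmul a x hx => rw [smul_lie]; exact J'.smul_mem a hx }
  rcases hI.eq_bot_or_eq_top I with hbot | htop
  · exact Or.inl (congrArg LieSubmodule.toSubmodule hbot)
  · exact Or.inr (congrArg LieSubmodule.toSubmodule htop)

/-- If `α = 0`, then `t ℂ[t, s]` is a proper submodule. -/
theorem ne_zero_of_isIrreducible (hI : LieModule.IsIrreducible ℂ Vir (Omega lam α h)) :
    α ≠ 0 := by
  rintro rfl
  have hop : ∀ (m : ℤ) (p : ℂ[X][X]), (Polynomial.C Polynomial.X : ℂ[X][X]) ∣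
      op lam 0 h m (Polynomial.C Polynomial.X * p) := by
    intro m p
    induction p using Polynomial.induction_on' with
    | add p q hp hq => rw [mul_add, map_add]; exact dvd_add hp hq
    | monomial i f =>
      rw [← Polynomial.C_mul_X_pow_eq_monomial, ← mul_assoc, ← Polynomial.C_mul, op_monomial]
      refine Dvd.dvd.mul_left (dvd_add ?_ ?_) _
      · rw [Polynomial.C_mul]
        exact (dvd_mul_right _ _).mul_left _
      · refine map_dvd Polynomial.C ?_
        -- For `α = 0` the operator on `ℂ[t]` is `f ↦ m h f - m t f'`, which preserves the multiples
        -- of `t`.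
        simp only [mul_zero, Polynomial.C_0, zero_mul, sub_zero]
        exact dvd_sub ((dvd_mul_right _ _).mul_left _) ((dvd_mul_left _ _).mul_right _)
  rcases eq_bot_or_eq_top_of_op_mem lam 0 h hI
    (LinearMap.range (LinearMap.mulLeft ℂ (Polynomial.C Polynomial.X : ℂ[X][X]))) (by
      rintro m _ ⟨p, rfl⟩
      obtain ⟨q, hq⟩ := hop m p
      exact ⟨q, hq.symm⟩) with hbot | htop
  · have h1 := LinearMap.range_eq_bot.mp hbot
    have h2 := DFunLike.congr_fun h1 1
    rw [LinearMap.mulLeft_apply, mul_one] at h2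
    exact Polynomial.X_ne_zero (Polynomial.C_eq_zero.mp h2)
  · obtain ⟨p, hp⟩ := LinearMap.range_eq_top.mp htop 1
    have h2 : IsUnit (Polynomial.C Polynomial.X : ℂ[X][X]) := IsUnit.of_mul_eq_one p hp
    exact Polynomial.not_isUnit_X (Polynomial.isUnit_C.mp h2)

end Omega

/-! ## Modules that are eventually like `Ω(λ, α, h)` -/

section EventualHom

variable {X : Type*} [AddCommGroup X] [Module ℂ X] [LieRingModule Vir X] [LieModule ℂ Vir X]

/-- The linear map `e` from `Ω(λ, α, h)` commutes with `d n` for all sufficiently large `n`. -/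
def IsEventualHom (lam : ℂˣ) (α : ℂ) (h : ℂ[X]) (e : ℂ[X][X] →ₗ[ℂ] X) : Prop :=
  ∃ K : ℤ, ∀ n ≥ K, ∀ p, ⁅Vir.d n, e p⁆ = e (Omega.op lam α h n p)

variable {lam : ℂˣ} {α : ℂ} {h : ℂ[X]} {e : ℂ[X][X] →ₗ[ℂ] X}

theorem IsEventualHom.smoothVectors_ne_top (he : IsEventualHom lam α h e)
    (hinj : Function.Injective e) : smoothVectors X ≠ ⊤ := by
  intro htop
  obtain ⟨K, hK⟩ := he
  have h1 : e (Omega.incl 1) ∈ smoothVectors X := htop ▸ LieSubmodule.mem_top _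
  obtain ⟨L, hL⟩ := h1
  have h2 := hL (max K L) (le_max_right _ _)
  rw [hK _ (le_max_left _ _)] at h2
  exact Omega.op_incl_one_ne_zero lam α h _ (hinj (h2.trans (map_zero e).symm))

/-- The bound `K` must not depend on `l`: for a given `l` only the finitely many `m` with `K ≤ m ≤ l
- K` are controlled, and `l` is later taken large enough for these to determine the top coefficient.
-/
theorem IsEventualHom.exists_polyTop (he : IsEventualHom lam α h e) (f : ℂ[X]) :
    ∃ K : ℤ, ∀ l, ∃ u, PolyTop 4 ((lam : ℂ) ^ l • e (Omega.incl (Omega.quadOp α h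
      (Omega.quadOp α h f)))) u ∧ ∀ m, K ≤ m → K ≤ l - m →
        ⁅Vir.d (l - m), ⁅Vir.d m, e (Omega.incl f)⁆⁆ = u m := by
  obtain ⟨K, hK⟩ := he
  refine ⟨K, fun l => ⟨_, by simpa only [map_smul] using
    (Omega.polyTop_op_op_incl lam α h l f).map e, fun m hm hlm => ?_⟩⟩
  rw [hK _ hm, hK _ hlm]

/-- For large indices, `d (l - m) d m` is polynomial in `m`, of degree less than `4`. -/
def EventuallyCubic (X : Type*) [AddCommGroup X] [Module ℂ X] [LieRingModule Vir X] : Prop :=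
  ∀ x : X, ∃ K : ℤ, ∀ l, ∃ u ∈ PolyLT X 4, ∀ m, K ≤ m → K ≤ l - m →
    ⁅Vir.d (l - m), ⁅Vir.d m, x⁆⁆ = u m

theorem EventuallyCubic.of_equiv {Y : Type*} [AddCommGroup Y] [Module ℂ Y] [LieRingModule Vir Y]
    [LieModule ℂ Vir Y] (φ : X ≃ₗ⁅ℂ,Vir⁆ Y) (hY : EventuallyCubic Y) : EventuallyCubic X := by
  intro x
  obtain ⟨K, hK⟩ := hY (φ x)
  refine ⟨K, fun l => ?_⟩
  obtain ⟨u, hu, hu'⟩ := hK l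
  refine ⟨_, polyLT_map (φ.symm : Y →ₗ[ℂ] X) hu, fun m hm hlm => ?_⟩
  rw [← hu' m hm hlm, ← LieModuleEquiv.apply_lie, ← LieModuleEquiv.apply_lie]
  exact (φ.symm_apply_apply _).symm

/-- The `m ^ 4` coefficient at `e f` is `λ ^ l e (Q (Q f))`, nonzero for a suitable `f`. Taking `l`
to be twice the common bound plus `4` leaves five consecutive admissible values of `m`. -/
theorem IsEventualHom.not_eventuallyCubic (he : IsEventualHom lam α h e)
    (hinj : Function.Injective e) (hα : α ≠ 0) : ¬ EventuallyCubic X := by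
  intro hX
  obtain ⟨f, hf⟩ := Omega.exists_quadOp_ne_zero α h hα
  obtain ⟨K, hK⟩ := he.exists_polyTop f
  obtain ⟨K', hK'⟩ := hX (e (Omega.incl f))
  obtain ⟨u, hu, hu'⟩ := hK (2 * max K K' + 4)
  obtain ⟨v, hv, hv'⟩ := hK' (2 * max K K' + 4)
  have h0 := (hu.sub (polyTop_zero_iff.mpr hv)).eq_zero (max K K') fun m hm hm' => by
    have h1 := le_max_left K K'
    have h2 := le_max_right K K'
    push_cast at hm'
    rw [← hu' m (by omega) (by omega), ← hv' m (by omega) (by omega), sub_self]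
  rw [sub_zero] at h0
  have h1 := (smul_eq_zero.mp h0).resolve_left (zpow_ne_zero _ lam.ne_zero)
  have h2 := hinj (h1.trans (map_zero e).symm)
  exact hf (Polynomial.C_eq_zero.mp h2)

end EventualHom

/-! ## The modules `A_b` -/

section TwistedWeylModules

variable (A : Type*) [AddCommGroup A] [Module ℂ A] [Module DiffOp A] [IsScalarTower ℂ DiffOp A]

theorem TwistedWeyl.lie_d (b : ℂ) (m : ℤ) (w : A) :
    (⁅Vir.d m, (w : TwistedWeyl A b)⁆ : TwistedWeyl A b) = (DiffOp.vect b m • w : A) := by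
  change chargelessRep (fun m => Module.toModuleEnd ℂ A (DiffOp.vect b m)) (Vir.d m) w = _
  rw [chargelessRep_d]
  rfl

theorem DiffOp.vect_sub_mul_vect (b : ℂ) (l m : ℤ) :
    vect b (l - m) * vect b m = (t l * D * D + ((l : ℂ) * b) • (t l * D)) +
      ((m : ℂ) ^ 1 • (t l * D + ((l : ℂ) * b * b) • t l) + (m : ℂ) ^ 2 • ((b - b * b) • t l)) := by
  have e1 : t (l - m) * D * (t m * D) = t l * D * D + (m : ℂ) • (t l * D) := by
    rw [mul_assoc, ← mul_assoc D, D_mul, add_mul, mul_add, smul_mul_assoc, mul_smul_comm,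
      ← mul_assoc, ← mul_assoc, t_mul, sub_add_cancel]
  have e2 : t (l - m) * D * t m = t l * D + (m : ℂ) • t l := by
    rw [mul_assoc, D_mul, mul_add, mul_smul_comm, ← mul_assoc, t_mul, sub_add_cancel]
  rw [vect, vect, add_mul, mul_add, mul_add, mul_smul_comm, smul_mul_assoc, smul_mul_assoc,
    mul_smul_comm, e1, e2, t_mul, ← mul_assoc, t_mul, sub_add_cancel]
  push_cast
  module

/-- The powers of `t` combine to `t ^ l`, and moving `D` past `t ^ m` produces one factor `m`, so
the product is quadratic in `m`. -/
theorem TwistedWeyl.eventuallyCubic (b : ℂ) : EventuallyCubic (TwistedWeyl A b) := by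
  intro (w : A)
  refine ⟨0, fun l => ⟨fun m => (DiffOp.vect b (l - m) * DiffOp.vect b m) • w, ?_, ?_⟩⟩
  · have key : ∀ c₀ c₁ c₂ : A, (fun m : ℤ => c₀ + ((m : ℂ) ^ 1 • c₁ + (m : ℂ) ^ 2 • c₂)) ∈
        PolyLT A 4 := fun c₀ c₁ c₂ =>
      Submodule.add_mem _ ((polyTop_const c₀).mem_polyLT (by omega))
        (Submodule.add_mem _ (polyLT_monomial (by omega) c₁) (polyLT_monomial (by omega) c₂))
    simp only [DiffOp.vect_sub_mul_vect, add_smul, smul_assoc _ _ w]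
    simpa only [add_smul, smul_assoc, smul_add] using! key
      ((DiffOp.t l * DiffOp.D * DiffOp.D + ((l : ℂ) * b) • (DiffOp.t l * DiffOp.D)) • w)
      ((DiffOp.t l * DiffOp.D + ((l : ℂ) * b * b) • DiffOp.t l) • w)
      (((b - b * b) • DiffOp.t l) • w)
  · intro m _ _
    refine Eq.trans ?_ (mul_smul (DiffOp.vect b (l - m)) (DiffOp.vect b m) w).symm
    refine (congrArg (fun z : TwistedWeyl A b => ⁅Vir.d (l - m), z⁆) (lie_d A b m w)).trans ?_
    exact lie_d A b (l - m) _

end TwistedWeylModules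

/-! ## The modules `N(M, β)` -/

namespace LoopMod

variable (k : ℕ) (M : Type*) [AddCommGroup M] [Module ℂ M] [LieRingModule (TruncVir k) M]
  [LieModule ℂ (TruncVir k) M]

theorem lie_d (β : ℂ[T;T⁻¹]) (m : ℤ) (x : LoopMod k M β) : ⁅Vir.d m, x⁆ = op k M β m x := by
  change chargelessRep (op k M β) (Vir.d m) x = _
  rw [chargelessRep_d]

/-- The coefficient of `m ^ (k + 1)` in `headOp k M m`. -/
noncomputable def topOp : Module.End ℂ M :=
  ((k + 1).factorial : ℂ)⁻¹ • LieModule.toEnd ℂ (TruncVir k) M (TruncVir.d k k)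

theorem topOp_injective (hM : ∀ w : M, ⁅TruncVir.d k k, w⁆ = 0 → w = 0) :
    Function.Injective (topOp k M) := by
  rw [injective_iff_map_eq_zero]
  intro w hw
  refine hM w ((smul_eq_zero.mp hw).resolve_left (inv_ne_zero ?_))
  exact_mod_cast (k + 1).factorial_ne_zero

theorem polyTop_headOp : PolyTop (k + 1) (topOp k M) (headOp k M) := by
  let c : ℕ → Module.End ℂ M := fun i => ((i + 1).factorial : ℂ)⁻¹ •
    (LieModule.toEnd ℂ (TruncVir k) M (TruncVir.d k i) : Module.End ℂ M)
  have h : ∀ m, headOp k M m = (m : ℂ) ^ (k + 1) • topOp k M +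
      (∑ i ∈ Finset.range k, fun m : ℤ => (m : ℂ) ^ (i + 1) • c i) m := by
    intro m
    rw [headOp, Finset.sum_range_succ, add_comm, Finset.sum_apply, topOp, smul_smul,
      div_eq_mul_inv]
    congr 1
    exact Finset.sum_congr rfl fun i _ => by rw [smul_smul, div_eq_mul_inv]
  have hc : (∑ i ∈ Finset.range k, fun m : ℤ => (m : ℂ) ^ (i + 1) • c i) ∈
      PolyLT (Module.End ℂ M) (k + 1) :=
    Submodule.sum_mem _ fun i hi =>
      polyLT_monomial (Nat.succ_lt_succ (Finset.mem_range.mp hi)) (c i)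
  have := (polyTop_monomial (k + 1) (topOp k M)).add_polyLT hc
  convert this using 1
  ext1 m
  exact h m

variable {M} in
/-- `TensorProduct.map f g z` as a linear function of `f`. -/
noncomputable def mapAt (g : Module.End ℂ ℂ[T;T⁻¹]) (z : M ⊗[ℂ] ℂ[T;T⁻¹]) :
    Module.End ℂ M →ₗ[ℂ] M ⊗[ℂ] ℂ[T;T⁻¹] where
  toFun f := TensorProduct.map f g z
  map_add' f f' := by rw [TensorProduct.map_add_left]; rfl
  map_smul' a f := by rw [TensorProduct.map_smul_left]; rfl

/-- With `D' = D + β` the action is `1 ⊗ t ^ m D' + H_m ⊗ t ^ m`, `H_m` being `headOp k M m`, and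
`D' t ^ m = t ^ m (D' + m)`. The product is arranged so that the first summand alone carries the top
degree in `m`. -/
theorem op_op_apply (β : ℂ[T;T⁻¹]) (l m : ℤ) (z : M ⊗[ℂ] ℂ[T;T⁻¹]) :
    op k M β (l - m) (op k M β m z) =
      mapAt (laurentMul (LaurentPolynomial.T l)) z (headOp k M (l - m) * headOp k M m) +
      (mapAt (laurentMul (LaurentPolynomial.T l) * (laurentD + laurentMul β)) z
          (headOp k M (l - m)) +
        (mapAt (laurentMul (LaurentPolynomial.T l) * (laurentD + laurentMul β)) z (headOp k M m) +
          ((m : ℂ) • mapAt (laurentMul (LaurentPolynomial.T l)) z (headOp k M m) +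
            ((m : ℂ) • mapAt (laurentMul (LaurentPolynomial.T l) * (laurentD + laurentMul β)) z 1 +
              mapAt (laurentMul (LaurentPolynomial.T l) * (laurentD + laurentMul β) *
                (laurentD + laurentMul β)) z 1)))) := by
  set τ : ℤ → Module.End ℂ ℂ[T;T⁻¹] := fun r => laurentMul (LaurentPolynomial.T r) with hτ
  set D' : Module.End ℂ ℂ[T;T⁻¹] := laurentD + laurentMul β with hD'
  have hop : ∀ r, op k M β r = TensorProduct.map 1 (τ r * D') +
      TensorProduct.map (headOp k M r) (τ r) := by
    intro r
    rw [op, hD', mul_add, TensorProduct.map_add_right, hτ]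
    simp only [laurentMul_mul, mul_comm β]
    change TensorProduct.map 1 _ + _ + TensorProduct.map 1 _ = _
    abel
  have hττ : τ (l - m) * τ m = τ l := by
    rw [hτ]
    simp only [laurentMul_mul, ← LaurentPolynomial.T_add, sub_add_cancel]
  have hDτ : D' * τ m = τ m * D' + (m : ℂ) • τ m := by
    rw [hD', hτ]
    simp only [add_mul, mul_add, laurentD_mul, laurentMul_mul, mul_comm β]
    abel
  rw [show laurentMul (LaurentPolynomial.T l) = τ l from rfl]
  clear_value τ D'
  have e1 : τ (l - m) * D' * τ m = τ l * D' + (m : ℂ) • τ l := by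
    rw [mul_assoc, hDτ, mul_add, ← mul_assoc, hττ, mul_smul_comm, hττ]
  have key : op k M β (l - m) * op k M β m =
      TensorProduct.map (headOp k M (l - m) * headOp k M m) (τ l) +
      (TensorProduct.map (headOp k M (l - m)) (τ l * D') +
        (TensorProduct.map (headOp k M m) (τ l * D') +
          ((m : ℂ) • TensorProduct.map (headOp k M m) (τ l) +
            ((m : ℂ) • TensorProduct.map 1 (τ l * D') +
              TensorProduct.map 1 (τ l * D' * D'))))) := by
    rw [hop, hop, add_mul, mul_add, mul_add, ← TensorProduct.map_mul, ← TensorProduct.map_mul,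
      ← TensorProduct.map_mul, ← TensorProduct.map_mul, ← mul_assoc, ← mul_assoc, e1, hττ,
      one_mul, one_mul, mul_one, add_mul, smul_mul_assoc, TensorProduct.map_add_right,
      TensorProduct.map_add_right, TensorProduct.map_smul_right, TensorProduct.map_smul_right]
    abel
  exact DFunLike.congr_fun key z

/-- The strongest competitor of the leading term is `m H_m`, of degree `k + 2`; it lies below `2 k +
2` because `k > 0`. -/
theorem polyTop_op_op_apply (hk : 0 < k) (β : ℂ[T;T⁻¹]) (l : ℤ) (z : M ⊗[ℂ] ℂ[T;T⁻¹]) :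
    PolyTop (k + 1 + (k + 1)) (TensorProduct.map ((-1 : ℂ) ^ (k + 1) • topOp k M * topOp k M)
      (laurentMul (LaurentPolynomial.T l)) z)
      (fun m => op k M β (l - m) (op k M β m z)) := by
  simp only [op_op_apply]
  have h1 := polyTop_headOp k M
  have h2 := h1.reflect l
  have h3 := (h2.mul h1).map (mapAt (laurentMul (LaurentPolynomial.T l)) z)
  refine h3.add_polyLT ?_
  refine Submodule.add_mem _ ((h2.map _).mem_polyLT (by omega)) (Submodule.add_mem _
    ((h1.map _).mem_polyLT (by omega)) (Submodule.add_mem _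
      ((polyTop_intCast.smul (h1.map _)).mem_polyLT (by omega)) (Submodule.add_mem _
        ((polyTop_intCast.smul (polyTop_const _)).mem_polyLT (by omega))
        ((polyTop_const _).mem_polyLT (by omega)))))

end LoopMod

theorem laurentMul_injective {p : ℂ[T;T⁻¹]} (hp : p ≠ 0) : Function.Injective (laurentMul p) :=
  mul_right_injective₀ hp

/-- With `z` the image of `e 1`, comparing top coefficients gives `(C ⊗ t ^ l) z = λ ^ l φ(g)` for
all large `l`, where `g` does not depend on `l`. Two consecutive `l` yield `(C ⊗ (t ^ (l + 1) - λ t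
^ l)) z = 0`, although this operator is injective and `z ≠ 0`. -/
theorem IsEventualHom.isEmpty_equiv_loopMod {X : Type*} [AddCommGroup X] [Module ℂ X]
    [LieRingModule Vir X] [LieModule ℂ Vir X] {lam : ℂˣ} {α : ℂ} {h : ℂ[X]}
    {e : ℂ[X][X] →ₗ[ℂ] X} (he : IsEventualHom lam α h e) (hinj : Function.Injective e)
    {k : ℕ} (hk : 0 < k) (M : Type*) [AddCommGroup M] [Module ℂ M] [LieRingModule (TruncVir k) M]
    [LieModule ℂ (TruncVir k) M] (hM : ∀ w : M, ⁅TruncVir.d k k, w⁆ = 0 → w = 0) (β : ℂ[T;T⁻¹]) :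
    IsEmpty (X ≃ₗ⁅ℂ,Vir⁆ LoopMod k M β) := by
  refine ⟨fun φ => ?_⟩
  obtain ⟨K, hK⟩ := he.exists_polyTop 1
  let z : M ⊗[ℂ] ℂ[T;T⁻¹] := φ (e (Omega.incl 1))
  let φ' : X →ₗ[ℂ] M ⊗[ℂ] ℂ[T;T⁻¹] := (φ : X →ₗ[ℂ] LoopMod k M β)
  have hz : z ≠ 0 := by
    intro hz
    have h1 : e (Omega.incl 1) = 0 := φ.injective (hz.trans (map_zero φ).symm)
    have h2 := hinj (h1.trans (map_zero e).symm)
    exact one_ne_zero (Polynomial.C_eq_zero.mp h2)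
  set C : Module.End ℂ M := (-1 : ℂ) ^ (k + 1) • LoopMod.topOp k M * LoopMod.topOp k M with hC
  have hCinj : Function.Injective C := by
    have h1 := LoopMod.topOp_injective k M hM
    rw [injective_iff_map_eq_zero]
    intro w hw
    rw [hC, smul_mul_assoc, LinearMap.smul_apply] at hw
    have h2 := (smul_eq_zero.mp hw).resolve_left (pow_ne_zero _ (neg_ne_zero.mpr one_ne_zero))
    exact h1 (h1 (by rw [map_zero, map_zero]; exact h2))
  -- The degree `2 k + 2` equals `4` for `k = 1`, where `g = e (Q (Q 1))`; for `k > 1` it exceeds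
  -- `4` and `g = 0`.
  obtain ⟨g, hg⟩ : ∃ g : X, ∀ l, ∃ u, PolyTop (k + 1 + (k + 1)) ((lam : ℂ) ^ l • g) u ∧
      ∀ m, K ≤ m → K ≤ l - m → ⁅Vir.d (l - m), ⁅Vir.d m, e (Omega.incl 1)⁆⁆ = u m := by
    by_cases hk1 : k = 1
    · subst hk1
      exact ⟨_, hK⟩
    · refine ⟨0, fun l => ?_⟩
      obtain ⟨u, hu, hu'⟩ := hK l
      refine ⟨u, ?_, hu'⟩
      rw [smul_zero, polyTop_zero_iff]
      exact hu.mem_polyLT (by omega)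
  -- For such `l`, every `m` from `K` to `K + 2 k + 2` also satisfies `K ≤ l - m`.
  have key : ∀ l ≥ 2 * K + (k + 1 + (k + 1) : ℕ), (lam : ℂ) ^ l • φ' g =
      TensorProduct.map C (laurentMul (LaurentPolynomial.T l)) z := by
    intro l hl
    obtain ⟨u, hu, hu'⟩ := hg l
    have h1 := hu.map φ'
    rw [map_smul] at h1
    refine sub_eq_zero.mp
      ((h1.sub (LoopMod.polyTop_op_op_apply k M hk β l z)).eq_zero K fun m hm hm' => ?_)
    rw [← hu' m hm (by omega), sub_eq_zero]
    change φ ⁅Vir.d (l - m), ⁅Vir.d m, e (Omega.incl 1)⁆⁆ = _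
    rw [LieModuleEquiv.apply_lie, LieModuleEquiv.apply_lie, LoopMod.lie_d, LoopMod.lie_d]
  set l : ℤ := 2 * K + (k + 1 + (k + 1) : ℕ) with hl
  have h1 := key l le_rfl
  have h2 := key (l + 1) (by omega)
  have h3 : laurentMul (LaurentPolynomial.T (l + 1) + (-lam : ℂ) • LaurentPolynomial.T l) =
      laurentMul (LaurentPolynomial.T (l + 1)) + (-lam : ℂ) • laurentMul (LaurentPolynomial.T l) := by
    refine LinearMap.ext fun p => ?_
    change (_ + _) * p = _ * p + (-lam : ℂ) • (_ * p)
    rw [add_mul, smul_mul_assoc]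
  have h4 : (LaurentPolynomial.T (l + 1) + (-lam : ℂ) • LaurentPolynomial.T l : ℂ[T;T⁻¹]) ≠ 0 := by
    intro h0
    have h5 := congrArg (AddMonoidAlgebra.coeffLinearEquiv ℂ) h0
    rw [map_add, map_smul, map_zero] at h5
    change Finsupp.single (l + 1) (1 : ℂ) + (-lam : ℂ) • Finsupp.single l (1 : ℂ) = 0 at h5
    have h6 := DFunLike.congr_fun h5 (l + 1)
    simp at h6
  refine hz (TensorProduct.map_injective_of_flat_flat _ _ hCinj (laurentMul_injective h4) ?_)
  rw [h3, TensorProduct.map_add_right, TensorProduct.map_smul_right, LinearMap.add_apply,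
    LinearMap.smul_apply, ← h1, ← h2, zpow_add_one₀ lam.ne_zero, map_zero]
  module

/-! ## The modules `Ω(μ_1, b_1) ⊗ ⋯ ⊗ Ω(μ_k, b_k) ⊗ W` -/

/-- Comparing `m` with `m + 1` gives `λ q(x + 1) = μ q(x)` at infinitely many integers, hence as
polynomials, and `q(x + 1)` has the same leading coefficient as `q`. -/
theorem eq_of_zpow_eq_zpow_mul_eval {μ lam : ℂ} (hμ : μ ≠ 0) (hlam : lam ≠ 0) (q : ℂ[X]) (K : ℤ)
    (h : ∀ m ≥ K, μ ^ m = lam ^ m * q.eval (m : ℂ)) : μ = lam := by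
  have hq : q ≠ 0 := by
    rintro rfl
    have := h K le_rfl
    rw [Polynomial.eval_zero, mul_zero] at this
    exact zpow_ne_zero K hμ this
  have h1 : Polynomial.C lam * Polynomial.taylor 1 q = Polynomial.C μ * q := by
    refine Polynomial.eq_of_infinite_eval_eq _ _
      (((Set.Ici_infinite K).image (Int.cast_injective (α := ℂ)).injOn).mono ?_)
    rintro _ ⟨m, hm, rfl⟩
    have h2 := h (m + 1) (le_trans hm (by omega))
    rw [zpow_add_one₀ hμ, zpow_add_one₀ hlam, h m hm] at h2
    change Polynomial.eval _ _ = Polynomial.eval _ _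
    rw [Polynomial.eval_mul, Polynomial.eval_mul, Polynomial.eval_C, Polynomial.eval_C,
      Polynomial.taylor_eval]
    push_cast at h2
    have h3 := zpow_ne_zero m hlam
    apply mul_left_cancel₀ h3
    rw [add_comm (m : ℂ)] at h2
    rw [add_comm (m : ℂ)]
    linear_combination -h2
  have h2 := congrArg Polynomial.leadingCoeff h1
  rw [Polynomial.leadingCoeff_mul, Polynomial.leadingCoeff_mul, Polynomial.leadingCoeff_C,
    Polynomial.leadingCoeff_C, Polynomial.leadingCoeff_taylor] at h2
  exact (mul_right_cancel₀ (Polynomial.leadingCoeff_ne_zero.mpr hq) h2).symm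

namespace OmegaOne

theorem lie_d (mu : ℂˣ) (b : ℂ) (m : ℤ) (x : OmegaOne mu b) : ⁅Vir.d m, x⁆ = op mu b m x := by
  change chargelessRep (op mu b) (Vir.d m) x = _
  rw [chargelessRep_d]

/-- The constant polynomial `1`. -/
noncomputable def one (mu : ℂˣ) (b : ℂ) : OmegaOne mu b := (1 : ℂ[X])

/-- The coefficient of `s ^ n`. -/
noncomputable def coeff (mu : ℂˣ) (b : ℂ) (n : ℕ) : OmegaOne mu b →ₗ[ℂ] ℂ := Polynomial.lcoeff ℂ n

theorem coeff_one (mu : ℂˣ) (b : ℂ) (n : ℕ) : coeff mu b n (one mu b) = if n = 0 then 1 else 0 :=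
  Polynomial.coeff_one

theorem coeff_one_lie (mu : ℂˣ) (b : ℂ) (m : ℤ) :
    coeff mu b 1 ⁅Vir.d m, one mu b⁆ = (mu : ℂ) ^ m := by
  rw [lie_d]
  change (Polynomial.C ((mu : ℂ) ^ m) * (Polynomial.X + Polynomial.C ((m : ℂ) * b)) *
    (1 : ℂ[X]).comp (Polynomial.X - Polynomial.C (m : ℂ))).coeff 1 = _
  rw [Polynomial.one_comp, mul_one, Polynomial.coeff_C_mul, Polynomial.coeff_add,
    Polynomial.coeff_X_one, Polynomial.coeff_C_succ, add_zero, mul_one]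

theorem op_op_apply (mu : ℂˣ) (b : ℂ) (l m : ℤ) (f : ℂ[X]) :
    op mu b (l - m) (op mu b m f) = (mu : ℂ) ^ l •
      ((Polynomial.X + ((l - m : ℤ) : ℂ) • Polynomial.C b) *
        (Polynomial.X - ((l - m : ℤ) : ℂ) • 1 + (m : ℂ) • Polynomial.C b) *
          f.comp (Polynomial.X - Polynomial.C (l : ℂ))) := by
  have e : (Polynomial.X - Polynomial.C (m : ℂ)).comp
      (Polynomial.X - Polynomial.C ((l - m : ℤ) : ℂ)) = Polynomial.X - Polynomial.C (l : ℂ) := by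
    rw [Polynomial.sub_comp, Polynomial.X_comp, Polynomial.C_comp, Int.cast_sub,
      Polynomial.C_sub]
    ring
  simp only [op, LinearMap.coe_mk, AddHom.coe_mk, Polynomial.mul_comp, Polynomial.add_comp,
    Polynomial.C_comp, Polynomial.X_comp, Polynomial.comp_assoc, e]
  have hl : (mu : ℂ) ^ l = (mu : ℂ) ^ (l - m) * (mu : ℂ) ^ m := by
    rw [← zpow_add₀ mu.ne_zero, sub_add_cancel]
  simp only [hl, Polynomial.smul_eq_C_mul, Polynomial.C_mul]
  ring

theorem op_op_mem_polyLT (mu : ℂˣ) (b : ℂ) (l : ℤ) (f : ℂ[X]) :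
    (fun m => op mu b (l - m) (op mu b m f)) ∈ PolyLT ℂ[X] 4 := by
  simp only [op_op_apply]
  have hX : (fun _ : ℤ => (Polynomial.X : ℂ[X])) ∈ PolyLT ℂ[X] 2 :=
    (polyTop_const _).mem_polyLT (by omega)
  have hl : ∀ c : ℂ[X], (fun m : ℤ => ((l - m : ℤ) : ℂ) • c) ∈ PolyLT ℂ[X] 2 := fun c =>
    ((polyTop_sub_intCast l).smul (polyTop_const c)).mem_polyLT (by omega)
  have hm : ∀ c : ℂ[X], (fun m : ℤ => (m : ℂ) • c) ∈ PolyLT ℂ[X] 2 := fun c =>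
    (polyTop_intCast.smul (polyTop_const c)).mem_polyLT (by omega)
  have h1 := Submodule.add_mem _ hX (hl (Polynomial.C b))
  have h2 := Submodule.add_mem _ (Submodule.sub_mem _ hX (hl 1)) (hm (Polynomial.C b))
  have h3 := polyLT_bilin (LinearMap.mul ℂ ℂ[X]) (g := 3) (by omega) h1 h2
  have h4 := polyLT_bilin (LinearMap.mul ℂ ℂ[X]) (g := 4) (by omega) h3
    ((polyTop_const (f.comp (Polynomial.X - Polynomial.C (l : ℂ)))).mem_polyLT zero_lt_one)
  exact Submodule.smul_mem _ ((mu : ℂ) ^ l) h4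

end OmegaOne

theorem PiTensorLie.lie_tprod {ι : Type*} [DecidableEq ι] [Fintype ι] {L : Type*} [LieRing L]
    [LieAlgebra ℂ L] {M : ι → Type*} [∀ i, AddCommGroup (M i)] [∀ i, Module ℂ (M i)]
    [∀ i, LieRingModule L (M i)] [∀ i, LieModule ℂ L (M i)] (x : L) (f : ∀ i, M i) :
    ⁅x, PiTensorProduct.tprod ℂ f⁆ =
      ∑ i, PiTensorProduct.tprod ℂ (Function.update f i ⁅x, f i⁆) := by
  change rep x _ = _
  rw [rep_apply, LinearMap.sum_apply]
  refine Finset.sum_congr rfl fun i _ => ?_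
  change PiTensorProduct.map _ _ = _
  rw [PiTensorProduct.map_tprod]
  congr 1
  ext1 j
  by_cases hj : j = i
  · subst hj; simp
  · simp [Function.update_of_ne hj]

section TensorModules

variable {k : ℕ} (mu : Fin k → ℂˣ) (b : Fin k → ℂ)

/-- The product of the coefficients of `s` in the `i`-th factor and of `1` in the others. -/
noncomputable def coeffProd (i : Fin k) : (⨂[ℂ] j, OmegaOne (mu j) (b j)) →ₗ[ℂ] ℂ :=
  PiTensorProduct.lift ((MultilinearMap.mkPiAlgebra ℂ (Fin k) ℂ).compLinearMap
    fun j => OmegaOne.coeff (mu j) (b j) (if j = i then 1 else 0))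

theorem coeffProd_tprod (i : Fin k) (f : ∀ j, OmegaOne (mu j) (b j)) :
    coeffProd mu b i (PiTensorProduct.tprod ℂ f) =
      ∏ j, OmegaOne.coeff (mu j) (b j) (if j = i then 1 else 0) (f j) := by
  rw [coeffProd, PiTensorProduct.lift.tprod]
  rfl

/-- Since `d m 1 = μ ^ m (s + m b)`, the factor `s` in position `i` can only come from `d m` acting
on that factor. -/
theorem coeffProd_lie_one (i : Fin k) (m : ℤ) :
    coeffProd mu b i ⁅Vir.d m, PiTensorProduct.tprod ℂ
      fun j => OmegaOne.one (mu j) (b j)⁆ = (mu i : ℂ) ^ m := by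
  rw [PiTensorLie.lie_tprod, map_sum, Finset.sum_eq_single i]
  · rw [coeffProd_tprod, Finset.prod_eq_single i]
    · rw [Function.update_self, if_pos rfl, OmegaOne.coeff_one_lie]
    · intro j _ hj
      rw [Function.update_of_ne hj, if_neg hj, OmegaOne.coeff_one, if_pos rfl]
    · simp
  · intro j _ hj
    rw [coeffProd_tprod]
    refine Finset.prod_eq_zero (Finset.mem_univ i) ?_
    rw [Function.update_of_ne hj.symm, if_pos rfl, OmegaOne.coeff_one, if_neg one_ne_zero]
  · simp

variable (W : Type*) [AddCommGroup W] [Module ℂ W] [LieRingModule Vir W] [LieModule ℂ Vir W]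

/-- For large indices `d n` kills the component in `W` and acts on the single factor `Ω(μ, b)` only,
where `d (l - m) d m` is a product of two factors linear in `m`. -/
theorem eventuallyCubic_tensor (mu : Fin 1 → ℂˣ) (b : Fin 1 → ℂ) (hW : smoothVectors W = ⊤) :
    EventuallyCubic ((⨂[ℂ] i, OmegaOne (mu i) (b i)) ⊗[ℂ] W) := by
  intro z
  induction z using TensorProduct.induction_on with
  | zero => exact ⟨0, fun l => ⟨0, Submodule.zero_mem _, fun m _ _ => by simp⟩⟩
  | add z z' h h' =>
    obtain ⟨K, hK⟩ := h
    obtain ⟨K', hK'⟩ := h'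
    refine ⟨max K K', fun l => ?_⟩
    obtain ⟨u, hu, hu'⟩ := hK l
    obtain ⟨v, hv, hv'⟩ := hK' l
    refine ⟨u + v, Submodule.add_mem _ hu hv, fun m hm hlm => ?_⟩
    rw [lie_add, lie_add, hu' m (le_of_max_le_left hm) (le_of_max_le_left hlm),
      hv' m (le_of_max_le_right hm) (le_of_max_le_right hlm), Pi.add_apply]
  | tmul y w =>
    have hw : w ∈ smoothVectors W := hW ▸ LieSubmodule.mem_top _
    obtain ⟨K, hK⟩ := hw
    refine ⟨K, fun l => ?_⟩
    suffices h : ∃ u ∈ PolyLT (⨂[ℂ] i, OmegaOne (mu i) (b i)) 4, ∀ m,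
        ⁅Vir.d (l - m), ⁅Vir.d m, y⁆⁆ = u m by
      obtain ⟨u, hu, hu'⟩ := h
      refine ⟨_, polyLT_map ((TensorProduct.mk ℂ _ W).flip w) hu, fun m hm hlm => ?_⟩
      rw [TensorProduct.LieModule.lie_tmul_right, hK m hm, TensorProduct.tmul_zero, add_zero,
        TensorProduct.LieModule.lie_tmul_right, hK _ hlm, TensorProduct.tmul_zero, add_zero, hu' m]
      rfl
    induction y using PiTensorProduct.induction_on with
    | smul_tprod r f =>
      let T : ℂ[X] →ₗ[ℂ] ⨂[ℂ] i, OmegaOne (mu i) (b i) :=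
        MultilinearMap.toLinearMap (PiTensorProduct.tprod ℂ) f 0
      refine ⟨_, Submodule.smul_mem _ r (polyLT_map T
        (OmegaOne.op_op_mem_polyLT (mu 0) (b 0) l (f 0))), fun m => ?_⟩
      rw [lie_smul, lie_smul, PiTensorLie.lie_tprod, Fin.sum_univ_one, PiTensorLie.lie_tprod,
        Fin.sum_univ_one, Function.update_self, Function.update_idem, OmegaOne.lie_d,
        OmegaOne.lie_d]
      rfl
    | add y y' h h' =>
      obtain ⟨u, hu, hu'⟩ := h
      obtain ⟨v, hv, hv'⟩ := h'
      refine ⟨u + v, Submodule.add_mem _ hu hv, fun m => ?_⟩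
      rw [lie_add, lie_add, hu', hv', Pi.add_apply]

end TensorModules

/-! ## The four comparisons -/

section Comparison

variable {X : Type u} [AddCommGroup X] [Module ℂ X] [LieRingModule Vir X] [LieModule ℂ Vir X]
  {lam : ℂˣ} {α : ℂ} {h : ℂ[X]} {e : ℂ[X][X] →ₗ[ℂ] X}

/-- The preimage of a vector chosen in another module need not lie in the image of one map `e`, so
the growth `λ ^ m` times a polynomial is needed for every vector. Sums of images of eventual
homomorphisms provide it. -/
theorem exists_lie_eq_zpow_smul
    (hspan : Submodule.span ℂ {x : X | ∃ e p, IsEventualHom lam α h e ∧ x = e p} = ⊤) (x : X) :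
    ∃ (K : ℤ) (d : ℕ), ∃ u ∈ PolyLT X d, ∀ m ≥ K, ⁅Vir.d m, x⁆ = (lam : ℂ) ^ m • u m := by
  have hx : x ∈ Submodule.span ℂ {x : X | ∃ e p, IsEventualHom lam α h e ∧ x = e p} :=
    hspan ▸ Submodule.mem_top
  induction hx using Submodule.span_induction with
  | zero => exact ⟨0, 0, 0, Submodule.zero_mem _, fun m _ => by simp⟩
  | add x y _ _ hx hy =>
    obtain ⟨K, d, u, hu, hu'⟩ := hx
    obtain ⟨L, e, v, hv, hv'⟩ := hy
    refine ⟨max K L, max d e, u + v, Submodule.add_mem _ (polyLT_mono (le_max_left _ _) hu)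
      (polyLT_mono (le_max_right _ _) hv), fun m hm => ?_⟩
    rw [lie_add, hu' m (le_of_max_le_left hm), hv' m (le_of_max_le_right hm), Pi.add_apply,
      smul_add]
  | smul a x _ hx =>
    obtain ⟨K, d, u, hu, hu'⟩ := hx
    refine ⟨K, d, a • u, Submodule.smul_mem _ a hu, fun m hm => ?_⟩
    rw [lie_smul, hu' m hm, smul_comm, Pi.smul_apply]
  | mem x hx =>
    obtain ⟨e, p, ⟨K, hK⟩, rfl⟩ := hx
    obtain ⟨d, u, hu, hu'⟩ := Omega.op_zpow_smul_polyLT lam α h p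
    refine ⟨K, d, _, polyLT_map e hu, fun m hm => ?_⟩
    rw [hK m hm, hu', map_smul]

theorem IsEventualHom.not_isTensorType (he : IsEventualHom lam α h e)
    (hinj : Function.Injective e) (hα : α ≠ 0) (hX : LieModule.IsIrreducible ℂ Vir X)
    (hspan : Submodule.span ℂ {x : X | ∃ e p, IsEventualHom lam α h e ∧ x = e p} = ⊤) :
    ¬ IsTensorType.{u, v} X := by
  rintro ⟨k, mu, b, W, _, _, _, _, hk, hmu, -, hWfin, ⟨φ⟩⟩
  -- `W` is not assumed irreducible, but it is a tensor factor of an irreducible module; this makes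
  -- it smooth.
  have hWirr : LieModule.IsIrreducible ℂ Vir W :=
    isIrreducible_right_of_tensorProduct (isIrreducible_of_equiv φ hX)
  have hW := hWfin.smoothVectors_eq_top hWirr
  have : Nontrivial W := hWirr.nontrivial_of_vir
  obtain ⟨w, hw⟩ := exists_ne (0 : W)
  obtain ⟨η, hη⟩ : ∃ η : Module.Dual ℂ W, η w ≠ 0 := by
    by_contra! h0
    exact hw ((Module.forall_dual_apply_eq_zero_iff ℂ w).mp h0)
  obtain ⟨L, hL⟩ : w ∈ smoothVectors W := hW ▸ LieSubmodule.mem_top _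
  -- The functional `ξ` reads off the coefficient of `s` in factor `i` and is normalised on `w`.
  -- Applied to `d m (1 ⊗ ⋯ ⊗ 1 ⊗ w)` it gives `μ_i ^ m`; computed in `X` the result is `λ ^ m`
  -- times a polynomial.
  have hlam : ∀ i, (mu i : ℂ) = lam := by
    intro i
    let y : ⨂[ℂ] j, OmegaOne (mu j) (b j) := PiTensorProduct.tprod ℂ fun j => OmegaOne.one (mu j) (b j)
    let ξ : (⨂[ℂ] j, OmegaOne (mu j) (b j)) ⊗[ℂ] W →ₗ[ℂ] ℂ :=
      (TensorProduct.lid ℂ ℂ).toLinearMap ∘ₗ TensorProduct.map (coeffProd mu b i) ((η w)⁻¹ • η)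
    obtain ⟨K, d, u, hu, hu'⟩ := exists_lie_eq_zpow_smul hspan (φ.symm (y ⊗ₜ w))
    obtain ⟨q, -, hq⟩ := exists_polynomial_of_mem_polyLT
      (polyLT_map (ξ ∘ₗ (φ : X →ₗ[ℂ] (⨂[ℂ] j, OmegaOne (mu j) (b j)) ⊗[ℂ] W)) hu)
    refine eq_of_zpow_eq_zpow_mul_eval (mu i).ne_zero lam.ne_zero q (max K L) fun m hm => ?_
    have h1 := congrArg φ (hu' m (le_of_max_le_left hm))
    rw [LieModuleEquiv.apply_lie, LieModuleEquiv.apply_symm_apply,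
      TensorProduct.LieModule.lie_tmul_right, hL m (le_of_max_le_right hm),
      TensorProduct.tmul_zero, add_zero, map_smul] at h1
    have h2 := congrArg ξ h1
    rw [map_smul] at h2
    have h3 : ξ (⁅Vir.d m, y⁆ ⊗ₜ w) = (mu i : ℂ) ^ m := by
      simp only [ξ, LinearMap.comp_apply, TensorProduct.map_tmul, LinearMap.smul_apply,
        LinearEquiv.coe_coe, TensorProduct.lid_tmul, smul_eq_mul, inv_mul_cancel₀ hη, mul_one]
      exact coeffProd_lie_one mu b i m
    rw [h3, smul_eq_mul] at h2
    rw [h2, ← hq m]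
    rfl
  obtain rfl : k = 1 := by
    have : Subsingleton (Fin k) :=
      ⟨fun i j => hmu (Units.ext ((hlam i).trans (hlam j).symm))⟩
    have := Fin.subsingleton_iff_le_one.mp this
    omega
  exact he.not_eventuallyCubic hinj hα ((eventuallyCubic_tensor W mu b hW).of_equiv φ)

theorem IsEventualHom.not_isLocallyFiniteType (he : IsEventualHom lam α h e)
    (hinj : Function.Injective e) : ¬ IsLocallyFiniteType.{u, v} X := by
  refine fun hX => he.smoothVectors_ne_top hinj ?_
  rcases hX with ⟨N, _, _, _, _, k, θ, -, -, -, hN, ⟨φ⟩⟩ | ⟨θ, η, ⟨φ⟩⟩ |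
    ⟨Y, _, _, _, _, hY, hYfin, ⟨φ⟩⟩
  · exact smoothVectors_eq_top_of_equiv φ (IndTheta.smoothVectors_eq_top N θ k hN)
  · exact smoothVectors_eq_top_of_equiv φ (HighestWeight.smoothVectors_eq_top θ η)
  · exact smoothVectors_eq_top_of_equiv φ (hYfin.smoothVectors_eq_top hY)

theorem IsEventualHom.not_isTwistedWeylType (he : IsEventualHom lam α h e)
    (hinj : Function.Injective e) (hα : α ≠ 0) : ¬ IsTwistedWeylType.{u, v} X := by
  rintro ⟨A, _, _, _, _, b, -, ⟨φ⟩⟩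
  exact he.not_eventuallyCubic hinj hα ((TwistedWeyl.eventuallyCubic A b).of_equiv φ)

theorem IsEventualHom.not_isLoopType (he : IsEventualHom lam α h e)
    (hinj : Function.Injective e) : ¬ IsLoopType.{u, v} X := by
  rintro ⟨k, M, _, _, _, _, β, hk, -, hM, ⟨φ⟩⟩
  exact (he.isEmpty_equiv_loopMod hinj hk M hM β).false φ

end Comparison

/-! ### Embeddings of `ℂ[t, s]` that commute with `d n` for large `n` -/

namespace Omega

variable (lam : ℂˣ) (α : ℂ) (h : ℂ[X])

/-- The identity map from `ℂ[t, s]` to `Ω(λ, α, h)`. -/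
noncomputable def ofPoly : ℂ[X][X] →ₗ[ℂ] Omega lam α h := LinearMap.id

theorem ofPoly_injective : Function.Injective (ofPoly lam α h) := Function.injective_id

theorem isEventualHom_ofPoly : IsEventualHom lam α h (ofPoly lam α h) :=
  ⟨0, fun n _ p => lie_d lam α h n p⟩

variable {V : Type*} [AddCommGroup V] [Module ℂ V]

/-- The map `p ↦ p ⊗ v` from `ℂ[t, s]` to `Ω(λ, α, h) ⊗ V`. -/
noncomputable def tmulRight (v : V) : ℂ[X][X] →ₗ[ℂ] Omega lam α h ⊗[ℂ] V :=
  (TensorProduct.mk ℂ (Omega lam α h) V).flip v ∘ₗ ofPoly lam α h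

theorem tmulRight_apply (v : V) (p : ℂ[X][X]) :
    tmulRight lam α h v p = ofPoly lam α h p ⊗ₜ[ℂ] v := rfl

theorem tmulRight_injective {v : V} (hv : v ≠ 0) : Function.Injective (tmulRight lam α h v) := by
  obtain ⟨ξ, hξ⟩ : ∃ ξ : Module.Dual ℂ V, ξ v ≠ 0 := by
    by_contra! h0
    exact hv ((Module.forall_dual_apply_eq_zero_iff ℂ v).mp h0)
  rw [injective_iff_map_eq_zero]
  intro p hp
  have h1 := congrArg (TensorProduct.rid ℂ (Omega lam α h))
    (congrArg (ξ.lTensor (Omega lam α h)) hp)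
  rw [tmulRight_apply, LinearMap.lTensor_tmul, TensorProduct.rid_tmul, map_zero, map_zero] at h1
  exact (smul_eq_zero.mp h1).resolve_left hξ

theorem isEventualHom_tmulRight [LieRingModule Vir V] [LieModule ℂ Vir V] {v : V}
    (hv : v ∈ smoothVectors V) : IsEventualHom lam α h (tmulRight lam α h v) := by
  obtain ⟨K, hK⟩ := hv
  refine ⟨K, fun n hn p => ?_⟩
  rw [tmulRight_apply, tmulRight_apply, TensorProduct.LieModule.lie_tmul_right, hK n hn,
    TensorProduct.tmul_zero, add_zero, lie_d]
  rfl

end Omega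

/-! ### The comparison for `Ω(λ, α, h)` and for its tensor product with `V` -/

theorem theorem4p2 (lam : ℂˣ) (α : ℂ) (h : ℂ[X])
    (V : Type u) [AddCommGroup V] [Module ℂ V] [LieRingModule Vir V] [LieModule ℂ Vir V]
    (hV : LieModule.IsIrreducible ℂ Vir V) (hVfin : EventuallyLocallyFinite V) :
    (LieModule.IsIrreducible ℂ Vir (Omega lam α h) →
      ¬ IsLocallyFiniteType.{0, v} (Omega lam α h) ∧
      ¬ IsTwistedWeylType.{0, v} (Omega lam α h) ∧
      ¬ IsLoopType.{0, v} (Omega lam α h) ∧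
      ¬ IsTensorType.{0, v} (Omega lam α h)) ∧
    (LieModule.IsIrreducible ℂ Vir (Omega lam α h ⊗[ℂ] V) →
      ¬ IsLocallyFiniteType.{u, v} (Omega lam α h ⊗[ℂ] V) ∧
      ¬ IsTwistedWeylType.{u, v} (Omega lam α h ⊗[ℂ] V) ∧
      ¬ IsLoopType.{u, v} (Omega lam α h ⊗[ℂ] V) ∧
      ¬ IsTensorType.{u, v} (Omega lam α h ⊗[ℂ] V)) 
:= by
  refine ⟨fun hI => ?_, fun hI => ?_⟩
  · have he := Omega.isEventualHom_ofPoly lam α h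
    have hinj := Omega.ofPoly_injective lam α h
    have hα := Omega.ne_zero_of_isIrreducible lam α h hI
    refine ⟨he.not_isLocallyFiniteType hinj, he.not_isTwistedWeylType hinj hα,
      he.not_isLoopType hinj, he.not_isTensorType hinj hα hI ?_⟩
    rw [eq_top_iff]
    exact fun x _ => Submodule.subset_span ⟨_, x, he, rfl⟩
  -- Irreducibility passes from the tensor product to the factor `Ω(λ, α, h)`, which is what
  -- excludes `α = 0`.
  · have hα := Omega.ne_zero_of_isIrreducible lam α h (isIrreducible_left_of_tensorProduct hI)
    have hsm := hVfin.smoothVectors_eq_top hV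
    have hmem : ∀ v : V, v ∈ smoothVectors V := fun v => hsm ▸ LieSubmodule.mem_top _
    have : Nontrivial V := hV.nontrivial_of_vir
    obtain ⟨v, hv⟩ := exists_ne (0 : V)
    have he := Omega.isEventualHom_tmulRight lam α h (hmem v)
    have hinj := Omega.tmulRight_injective lam α h hv
    refine ⟨he.not_isLocallyFiniteType hinj, he.not_isTwistedWeylType hinj hα,
      he.not_isLoopType hinj, he.not_isTensorType hinj hα hI ?_⟩
    rw [eq_top_iff]
    intro z _
    induction z using TensorProduct.induction_on with
    | zero => exact Submodule.zero_mem _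
    | add z z' h h' => exact Submodule.add_mem _ (h trivial) (h' trivial)
    | tmul p w =>
      exact Submodule.subset_span ⟨_, p, Omega.isEventualHom_tmulRight lam α h (hmem w), rfl⟩
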